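/- Let $r\ge 0$, $d\ge 2$ be integers with $r\le \frac d2-1$, and let $n:=d-1$. Tensors in $\mathbb C^{d\times d\times d}$ and vectors in $\mathbb C^d$ are labelled by $0,1,\dots,n$. Let $\Omega$ be the set of labels $(a,b,c)$ with $a,b,c$ pairwise distinct, and let $\|T_\Omega\|:=\big(\sum_{(a,b,c)\in\Omega}|T_{abc}|^2\big)^{1/2}$. Write $[r]=\{1,\dots,r\}$ and $[r+1,n]=\{r+1,\dots,n\}$. For an array $G=(G(k,i,j))_{k,i\in[r],\,j\in[r+1,n]}$ of complex numbers and $l\in[r+1,n]$ let $N_l(G)\in\mathbb C^{r\times r}$ be the matrix with $(i,k)$ entry $G(k,i,l)$, and for $\xi\in\mathbb C^{[r+1,n]}$ let $N(\xi,G):=\sum_{l=r+1}^n\xi_lN_l(G)$. Call $G$ a generating matrix of $\mathcal F$ if $\sum_{k=1}^r G(k,i,j)\mathcal F_{0kt}=\mathcal F_{ijt}$ for all $i\in[r]$, $j\in[r+1,n]$, $t=0,\dots,n$. **Algorithm** (input: a symmetric tensor $\widehat{\mathcal F}$, of which only the entries in $\Omega$ are used, and a vector $\xi\in\mathbb C^{[r+1,n]}$).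 1. For all $i\in[r]$, $j\in[r+1,n]$ let $\widehat G(\cdot,i,j)$ be a minimizer over $g\in\mathbb C^r$ of $\sum_{l\in[r+1,n],\,l\ne j}\big|\sum_{k=1}^r\widehat{\mathcal F}_{0kl}\,g_k-\widehat{\mathcal F}_{ijl}\big|^2$. 2. Let $\hat v_1,\dots,\hat v_r\in\mathbb C^r$ be linearly independent unit length eigenvectors of $N(\xi,\widehat G)$, and let $\hat w_k:=(\hat v_k^HN_l(\widehat G)\hat v_k)_{l=r+1}^n$. 3. Let $\hat\beta$ be a minimizer over $\beta\in\mathbb C^r$ of $\sum_{a\in[r],\,l\in[r+1,n]}|\widehat{\mathcal F}_{0al}-\sum_k\beta_k(\hat v_k)_a(\hat w_k)_l|^2$ and $\hat\theta$ a minimizer over $\theta\in\mathbb C^r$ of $\sum_{a\ne b\in[r],\,l\in[r+1,n]}|\widehat{\mathcal F}_{abl}-\sum_k\theta_k(\hat v_k)_a(\hat v_k)_b(\hat w_k)_l|^2$. Put $\hat\lambda_k:=\hat\beta_k^2/\hat\theta_k$ and $\hat\gamma_k:=\hat\theta_k/\hat\beta_k$. 4. Let $\hat p_k:=\sqrt[3]{\hat\lambda_k}\,(1,\hat\gamma_k\hat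 v_k,\hat w_k)\in\mathbb C^d$, with the principal cube root. 5. Let $(p_1^*,\dots,p_r^*)$ be a minimizer over $(q_1,\dots,q_r)\in(\mathbb C^d)^r$ of $\big\|\big(\sum_kq_k^{\otimes3}-\widehat{\mathcal F}\big)_\Omega\big\|^2$. **Theorem.** Let $\mathcal F\in\mathbb C^{d\times d\times d}$ and $\xi\in\mathbb C^{[r+1,n]}$. There are constants $\delta>0$ and $C>0$, depending only on $\mathcal F$ and $\xi$, such that the following holds whenever $\mathcal F=\sum_{i=1}^rp_i^{\otimes3}$ with $p_1,\dots,p_r\in\mathbb C^d$ satisfying - (i) $(p_i)_0\ne0$ for each $i$; - (ii) the subvectors of $p_1,\dots,p_r$ with labels $1,\dots,r$ are linearly independent; - (iii) for each $j\in[r+1,n]$, the subvectors of $p_1,\dots,p_r$ with labels in $[r+1,n]\setminus\{j\}$ are linearly independent; - (iv) the eigenvalues of $N(\xi,G)$ are pairwise distinct, where $G$ is the generating matrix of $\mathcal F$ (which exists and is unique by (i)–(ii)). Let $\widehat{\mathcal F}$ be a symmetric tensor with $\epsilon:=\|(\widehat{\mathcal F}-\mathcal F)_\Omega\|\le\delta$.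 Then all choices in Steps 1–3 of the algorithm can be made, and the problem in Step 5 has a minimizer. Moreover: - (a) Suppose in addition that each subvector $((p_i)_1,\dots,(p_i)_r)$ has at least two nonzero entries. Then, for all choices in Steps 1–3, $\hat\beta_k\neq 0$ and $\hat\theta_k\ne0$ for all $k$, and there are a permutation $\sigma$ of $[r]$ and scalars $\hat\tau_i$ with $\hat\tau_i^3=1$ and $\|\hat\tau_i\hat p_i-p_{\sigma(i)}\|\le C\epsilon$ for all $i$. - (b) For every minimizer $(p_1^*,\dots,p_r^*)$ in Step 5 there are a permutation $\sigma$ of $[r]$ and scalars $\tau_i^*$ with $(\tau_i^*)^3=1$ and $\|\tau_i^*p_i^*-p_{\sigma(i)}\|\le C\epsilon$ for all $i$. -/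

import Mathlib

/-!
Incomplete symmetric tensor approximation of order three.  Tensor labels are `0, 1, …, n` with
`n = d - 1`, i.e. the elements of `Fin d`.  The standing assumption `r ≤ d / 2 - 1` is written
`2 * r + 2 ≤ d`.
-/

namespace IncompleteTensor

noncomputable section

/-- Tensors of order three over `ℂ ^ d`. -/
abbrev Tensor (d : ℕ) : Type := Fin d → Fin d → Fin d → ℂ

/-- Symmetric tensors: entries are invariant under all permutations of the labels. -/
def IsSymmetric {d : ℕ} (T : Tensor d) : Prop :=
  ∀ a b c, T a b c = T b a c ∧ T a b c = T a c b

/-- The norm `‖T_Ω‖`, where `Ω` consists of the labels `(a, b, c)` with `a`, `b`, `c` distinct. -/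
def normOmega {d : ℕ} (T : Tensor d) : ℝ :=
  Real.sqrt (∑ a, ∑ b, ∑ c, if a ≠ b ∧ a ≠ c ∧ b ≠ c then ‖T a b c‖ ^ 2 else 0)

/-- The tensor `q₁^{⊗3} + ⋯ + q_r^{⊗3}`. -/
def sumCubes {d r : ℕ} (q : Fin r → EuclideanSpace ℂ (Fin d)) : Tensor d :=
  fun a b c => ∑ i, q i a * q i b * q i c

/-- The label `0`. -/
def zeroLabel {d r : ℕ} (h : 2 * r + 2 ≤ d) : Fin d := ⟨0, by omega⟩

/-- The labels `1, …, r`; the element `k` of `Fin r` (which starts at `0`) gives the label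
`k + 1`. -/
def low {d r : ℕ} (h : 2 * r + 2 ≤ d) (k : Fin r) : Fin d := ⟨k.val + 1, by omega⟩

/-- The labels `r + 1, …, n`. -/
abbrev High (d r : ℕ) : Type := {l : Fin d // r < l.val}

/-- The space `ℂ^{[r] × 𝓑₁}`: the entry `G k i j` is the one at `(k, e_i + e_j)`, where `i` is
a label in `[r]` and `j` one in `[r + 1, n]`. -/
abbrev GenMatrix (d r : ℕ) : Type := Fin r → Fin r → High d r → ℂ

/-- `G` is a generating matrix of `F`: each polynomial
`∑ k, G(k, e_i + e_j) x_k - x_i x_j` is a generating polynomial of `F`. -/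
def IsGeneratingMatrix {d r : ℕ} (h : 2 * r + 2 ≤ d) (F : Tensor d) (G : GenMatrix d r) : Prop :=
  ∀ (i : Fin r) (j : High d r) (t : Fin d),
    ∑ k, G k i j * F (zeroLabel h) (low h k) t - F (low h i) j.1 t = 0

/-- The matrix `N_l(G)`, whose entry at `(i, k)` is `G(k, e_i + e_l)`. -/
def Nmat {d r : ℕ} (G : GenMatrix d r) (l : High d r) : Matrix (Fin r) (Fin r) ℂ :=
  Matrix.of fun i k => G k i l

/-- The matrix `N(ξ) = ξ_{r+1} N_{r+1}(G) + ⋯ + ξ_n N_n(G)`. -/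
def Nxi {d r : ℕ} (ξ : High d r → ℂ) (G : GenMatrix d r) : Matrix (Fin r) (Fin r) ℂ :=
  ∑ l, ξ l • Nmat G l

/-- The eigenvalues of a complex matrix (with algebraic multiplicity) are pairwise distinct. -/
def DistinctEigenvalues {r : ℕ} (M : Matrix (Fin r) (Fin r) ℂ) : Prop :=
  M.charpoly.roots.Nodup

/-- The matrix `A_{ij}[F]` (it does not depend on `i`): rows are labelled by the
`l ∈ [r + 1, n]` with `l ≠ j`. -/
def Amat {d r : ℕ} (h : 2 * r + 2 ≤ d) (F : Tensor d) (j : High d r) :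
    Matrix {l : High d r // l ≠ j} (Fin r) ℂ :=
  Matrix.of fun l k => F (zeroLabel h) (low h k) l.1.1

/-- The vector `b_{ij}[F]`. -/
def bvec {d r : ℕ} (h : 2 * r + 2 ≤ d) (F : Tensor d) (i : Fin r) (j : High d r) :
    {l : High d r // l ≠ j} → ℂ :=
  fun l => F (low h i) j.1 l.1.1

/-- The objective `‖A_{ij}[F] g - b_{ij}[F]‖²` (Euclidean norm). -/
def genObjective {d r : ℕ} (h : 2 * r + 2 ≤ d) (F : Tensor d) (i : Fin r) (j : High d r)
    (g : Fin r → ℂ) : ℝ :=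
  ∑ l, ‖((Amat h F j).mulVec g - bvec h F i j) l‖ ^ 2

/-- The vector `(v^H N_{r+1}(G) v, …, v^H N_n(G) v)`. -/
def wvec {d r : ℕ} (G : GenMatrix d r) (v : EuclideanSpace ℂ (Fin r)) : High d r → ℂ :=
  fun l => star v.ofLp ⬝ᵥ (Nmat G l).mulVec v.ofLp

/-- The objective `‖F_{J₁} - ∑ k, β_k v_k ⊗ w_k‖²`, where `J₁` consists of the labels
`(0, a, l)` with `a ∈ [r]` and `l ∈ [r + 1, n]`. -/
def betaObjective {d r : ℕ} (h : 2 * r + 2 ≤ d) (F : Tensor d)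
    (v : Fin r → EuclideanSpace ℂ (Fin r)) (w : Fin r → High d r → ℂ) (β : Fin r → ℂ) : ℝ :=
  ∑ a, ∑ l, ‖F (zeroLabel h) (low h a) l.1 - ∑ k, β k * (v k a * w k l)‖ ^ 2

/-- The objective `‖F_{J₂} - ∑ k, θ_k (v_k ⊗ v_k ⊗ w_k)_{J₂}‖²`, where `J₂` consists of the labels
`(a, b, l)` with `a ≠ b` in `[r]` and `l ∈ [r + 1, n]`. -/
def thetaObjective {d r : ℕ} (h : 2 * r + 2 ≤ d) (F : Tensor d)
    (v : Fin r → EuclideanSpace ℂ (Fin r)) (w : Fin r → High d r → ℂ) (θ : Fin r → ℂ) : ℝ :=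
  ∑ a, ∑ b, ∑ l, if a ≠ b then
    ‖F (low h a) (low h b) l.1 - ∑ k, θ k * (v k a * v k b * w k l)‖ ^ 2 else 0

/-- A run of Steps 1-3 of the algorithm on the input `F` with the vector `ξ`: all choices made
on the way (minimizers of the linear least squares problems, eigenvectors). -/
structure Run {d r : ℕ} (h : 2 * r + 2 ≤ d) (F : Tensor d) (ξ : High d r → ℂ) where
  /-- the matrix `Ĝ` -/
  G : GenMatrix d r
  G_min : ∀ i j, IsMinOn (genObjective h F i j) Set.univ (fun k => G k i j)
  /-- a full set of unit length eigenvectors of `N̂(ξ)` -/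
  v : Fin r → EuclideanSpace ℂ (Fin r)
  v_unit : ∀ k, ‖v k‖ = 1
  v_eigen : ∀ k, ∃ μ : ℂ, (Nxi ξ G).mulVec (v k).ofLp = μ • (v k).ofLp
  v_indep : LinearIndependent ℂ v
  /-- the minimizer `β̂` -/
  β : Fin r → ℂ
  β_min : IsMinOn (betaObjective h F v (fun k => wvec G (v k))) Set.univ β
  /-- the minimizer `θ̂` -/
  θ : Fin r → ℂ
  θ_min : IsMinOn (thetaObjective h F v (fun k => wvec G (v k))) Set.univ θ

namespace Run

variable {d r : ℕ} {h : 2 * r + 2 ≤ d} {F : Tensor d} {ξ : High d r → ℂ}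

/-- `λ̂_k = β̂_k² / θ̂_k` -/
def lam (R : Run h F ξ) (k : Fin r) : ℂ := R.β k ^ 2 / R.θ k

/-- `γ̂_k = θ̂_k / β̂_k` -/
def gam (R : Run h F ξ) (k : Fin r) : ℂ := R.θ k / R.β k

/-- Step 4: the vector `p̂_k = λ̂_k^{1/3} (1, γ̂_k v̂_k, ŵ_k)`, with the principal cube root. -/
def phat (R : Run h F ξ) (k : Fin r) : EuclideanSpace ℂ (Fin d) :=
  WithLp.toLp 2 fun a =>
    R.lam k ^ (1 / 3 : ℂ) *
      (if h0 : a.val = 0 then 1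
       else if ha : a.val ≤ r then R.gam k * R.v k ⟨a.val - 1, by omega⟩
       else wvec R.G (R.v k) ⟨a, by omega⟩)

end Run

/-- Step 5: `(q₁, …, q_r)` minimizes `‖(q₁^{⊗3} + ⋯ + q_r^{⊗3} - F)_Ω‖²`. -/
def IsOptimizer {d r : ℕ} (F : Tensor d) (q : Fin r → EuclideanSpace ℂ (Fin d)) : Prop :=
  IsMinOn (fun q' : Fin r → EuclideanSpace ℂ (Fin d) => normOmega (sumCubes q' - F) ^ 2)
    Set.univ q

/-- Up to a permutation of `(p₁, …, p_r)` and cube roots of unity, the vectors `q_i` are within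
distance `η` of the `p_i`. -/
def CloseUpToSymmetry {d r : ℕ} (q p : Fin r → EuclideanSpace ℂ (Fin d)) (η : ℝ) : Prop :=
  ∃ (σ : Equiv.Perm (Fin r)) (τ : Fin r → ℂ), ∀ i, τ i ^ 3 = 1 ∧ ‖τ i • q i - p (σ i)‖ ≤ η

end

end IncompleteTensor

/-! Scale leading entries to one: `p k = p k 0 • (1, x k, w k)`, with `λ k = (p k 0)³`. If `G` is
prescribed by `N_l(G) x k = (w k)_l x k`, then `G` generates `F`, so the decomposition can be read
off by linear algebra. A linear system gives `G`, the eigenvectors of `N(ξ, G)` give the directions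
of the `x k`, Rayleigh quotients give the `w k`, and two more linear systems give the scales. These
systems involve only entries of `F` in `Ω`, are consistent for the exact tensor, and have full
column rank; for the system of `θ` this uses two nonzero entries in each `x k`.

Two perturbation results carry the proof. Least squares solutions of a consistent system of full
column rank move by `O(ε)` (`ApproxTo.leastSquares`). Unit eigenvectors of a matrix with distinct
eigenvalues move by `O(ε)`, up to a permutation and phases (`exists_eigenvector_matching`). The
phases cancel in `w`, in `β² / θ` and in `(θ / β) v`; only a cube root of unity remains.

For Step 5, any `q` whose sum of cubes is near `F` on `Ω` is near `p` up to symmetry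
(`Regular.exists_approx_of_sumCubes`). Indeed the generating matrix of `q` solves the least squares
problems of its own tensor exactly, so the same perturbation argument applies to it. An optimizer is
within `2ε` of `F` on `Ω`, hence near `p`. The same stability bounds the relevant sublevel set, so
an optimizer exists; with error zero it shows that `p` is unique up to symmetry, so the constants
depend only on `F` and `ξ`.

Uniformity is handled by filters. All data (tensors, or tensors with a run) form a type `X` with an
error function `e`, and `O(e)` along `comap e (𝓝 0)` is a Lipschitz bound valid for all data of
small error. -/

namespace IncompleteTensor

open Asymptotics Filter Topology

/-! ### Approximation to first order along a filter -/

section Approx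

variable {X : Type*} {l : Filter X} {e : X → ℝ}
variable {E : Type*} [NormedAddCommGroup E]

/-- Along `l`, the family `f` is within a constant multiple of the error `e` of the value `c`. -/
def ApproxTo (l : Filter X) (e : X → ℝ) (f : X → E) (c : E) : Prop :=
  (fun x => f x - c) =O[l] e

namespace ApproxTo

theorem const (c : E) : ApproxTo l e (fun _ => c) c := by
  simpa [ApproxTo] using isBigO_zero e l

theorem congr' {f g : X → E} {c : E} (hf : ApproxTo l e f c) (h : f =ᶠ[l] g) :
    ApproxTo l e g c :=
  IsBigO.congr' hf (h.mono fun x hx => by simp [hx]) (EventuallyEq.refl _ _)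

theorem congr {f g : X → E} {c c' : E} (hf : ApproxTo l e f c) (h : ∀ x, f x = g x)
    (hc : c = c') : ApproxTo l e g c' := by
  subst hc
  exact hf.congr' (Eventually.of_forall h)

theorem of_norm_le {f : X → E} {c : E} (h : ∀ x, ‖f x - c‖ ≤ e x) : ApproxTo l e f c :=
  IsBigO.of_norm_le h

theorem sub {f g : X → E} {c c' : E} (hf : ApproxTo l e f c) (hg : ApproxTo l e g c') :
    ApproxTo l e (fun x => f x - g x) (c - c') :=
  (IsBigO.sub hf hg).congr_left fun _ => sub_sub_sub_comm _ _ _ _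

theorem sum {ι : Type*} {s : Finset ι} {f : ι → X → E} {c : ι → E}
    (h : ∀ i ∈ s, ApproxTo l e (f i) (c i)) :
    ApproxTo l e (fun x => ∑ i ∈ s, f i x) (∑ i ∈ s, c i) :=
  (IsBigO.fun_sum (g := e) (l := l) h).congr_left fun x => by simp

theorem tendsto (he : Tendsto e l (𝓝 0)) {f : X → E} {c : E} (hf : ApproxTo l e f c) :
    Tendsto f l (𝓝 c) := by
  have := (IsBigO.trans_tendsto hf he)
  simpa using this.add_const c

theorem mul (he : Tendsto e l (𝓝 0)) {f g : X → ℂ} {c c' : ℂ}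
    (hf : ApproxTo l e f c) (hg : ApproxTo l e g c') :
    ApproxTo l e (fun x => f x * g x) (c * c') := by
  have h1 : (fun x => (f x - c) * g x) =O[l] e := by
    simpa using IsBigO.mul hf ((hg.tendsto he).isBigO_one ℝ)
  have h2 : (fun x => c * (g x - c')) =O[l] e := IsBigO.const_mul_left hg c
  exact (h1.add h2).congr_left fun x => by ring

theorem comp_differentiableAt (he : Tendsto e l (𝓝 0)) {φ : ℂ → ℂ} {f : X → ℂ} {c : ℂ}
    (hφ : DifferentiableAt ℂ φ c) (hf : ApproxTo l e f c) :
    ApproxTo l e (fun x => φ (f x)) (φ c) :=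
  (hφ.isBigO_sub.comp_tendsto (hf.tendsto he)).trans hf

theorem inv (he : Tendsto e l (𝓝 0)) {f : X → ℂ} {c : ℂ} (hc : c ≠ 0)
    (hf : ApproxTo l e f c) : ApproxTo l e (fun x => (f x)⁻¹) c⁻¹ :=
  comp_differentiableAt he (differentiableAt_inv hc) hf

theorem div (he : Tendsto e l (𝓝 0)) {f g : X → ℂ} {c c' : ℂ} (hc : c' ≠ 0)
    (hf : ApproxTo l e f c) (hg : ApproxTo l e g c') :
    ApproxTo l e (fun x => f x / g x) (c / c') := by
  simpa only [div_eq_mul_inv] using hf.mul he (hg.inv he hc)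

theorem star {f : X → ℂ} {c : ℂ} (hf : ApproxTo l e f c) :
    ApproxTo l e (fun x => star (f x)) (star c) :=
  IsBigO.of_norm_left ((IsBigO.norm_left hf).congr_left fun x => by rw [← star_sub, norm_star])

theorem euclidean {ι : Type*} [Fintype ι] {f : X → EuclideanSpace ℂ ι} {c : EuclideanSpace ℂ ι}
    (h : ∀ i, ApproxTo l e (fun x => f x i) (c i)) : ApproxTo l e f c := by
  have h1 : (fun x => (f x - c).ofLp) =O[l] e := isBigO_pi.2 h
  exact ((EuclideanSpace.equiv ι ℂ).symm.toContinuousLinearMap.isBigO_comp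
    (fun x => (f x - c).ofLp) l).trans h1

end ApproxTo

theorem eventually_comap_zero {e : X → ℝ} (he : ∀ x, 0 ≤ e x) {P : X → Prop}
    (h : ∀ᶠ x in comap e (𝓝 0), P x) : ∃ δ > 0, ∀ x, e x ≤ δ → P x := by
  obtain ⟨t, ht, hP⟩ := mem_comap.1 h
  obtain ⟨δ, hδ, hball⟩ := Metric.mem_nhds_iff.1 ht
  -- Halving turns the open ball into the closed condition `e x ≤ δ`.
  refine ⟨δ / 2, by positivity, fun x hx => hP (hball ?_)⟩
  rw [mem_ball_zero_iff, Real.norm_of_nonneg (he x)]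
  linarith

/-- A first order approximation along `comap e (𝓝 0)` is a uniform Lipschitz bound. -/
theorem exists_bound_of_approxTo {ι : Type*} [Fintype ι] {e : X → ℝ} (he : ∀ x, 0 ≤ e x)
    {f : ι → X → E} {c : ι → E} (h : ∀ i, ApproxTo (comap e (𝓝 0)) e (f i) (c i)) :
    ∃ δ > 0, ∃ C > 0, ∀ x, e x ≤ δ → ∀ i, ‖f i x - c i‖ ≤ C * e x := by
  have h1 : (fun x i => f i x - c i) =O[comap e (𝓝 0)] e := isBigO_pi.2 h
  obtain ⟨C, hC, hb⟩ := h1.exists_pos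
  obtain ⟨δ, hδ, H⟩ := eventually_comap_zero he hb.bound
  refine ⟨δ, hδ, C, hC, fun x hx i => ?_⟩
  have := H x hx
  rw [Real.norm_of_nonneg (he x)] at this
  exact (norm_le_pi_norm (fun i => f i x - c i) i).trans this

/-- Approximating the cube of `c ≠ 0` means approximating `c` up to a cube root of unity. -/
theorem exists_cube_root_approx (he : Tendsto e l (𝓝 0)) {z : X → ℂ} {c : ℂ} (hc : c ≠ 0)
    (hz : ApproxTo l e (fun x => z x ^ 3) (c ^ 3)) :
    ∃ τ : X → ℂ, (∀ x, τ x ^ 3 = 1) ∧ ApproxTo l e (fun x => τ x * z x) c := by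
  have hc3 : c ^ 3 ≠ 0 := pow_ne_zero 3 hc
  -- The principal cube root is applied only near `1`, where it is differentiable. Since `s` and `z`
  -- have equal cubes, `s / z` is the desired root of unity; at `z = 0` also `s = 0`, so the value
  -- `1` is harmless.
  set s : X → ℂ := fun x => c * (z x ^ 3 / c ^ 3) ^ (1 / 3 : ℂ) with hs
  have hs3 : ∀ x, s x ^ 3 = z x ^ 3 := fun x => by
    have : ((z x ^ 3 / c ^ 3) ^ (1 / 3 : ℂ)) ^ 3 = z x ^ 3 / c ^ 3 := by
      simp
    rw [hs]; simp only [mul_pow, this]; field_simp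
  refine ⟨fun x => if z x = 0 then 1 else s x / z x, fun x => ?_, ?_⟩
  · dsimp only
    split_ifs with h
    · simp
    · rw [div_pow, hs3, div_self (pow_ne_zero 3 h)]
  have h1 : ApproxTo l e (fun x => z x ^ 3 / c ^ 3) 1 :=
    (hz.div he hc3 (ApproxTo.const _)).congr (fun _ => rfl) (div_self hc3)
  have h2 : ApproxTo l e s c :=
    ((ApproxTo.const c).mul he (h1.comp_differentiableAt he (φ := fun w => w ^ (1 / 3 : ℂ))
      (differentiableAt_id.cpow_const (by simp)))).congr (fun _ => rfl) (by simp)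
  refine h2.congr (fun x => ?_) rfl
  dsimp only
  split_ifs with h
  · have := hs3 x
    rw [h] at this ⊢
    simpa using this
  · field_simp

end Approx

/-! ### Linear least squares -/

section LeastSquares

variable {X : Type*} {l : Filter X} {e : X → ℝ} {m n : Type*} [Fintype m] [Fintype n]

/-- Solutions of a perturbed, consistent linear system of full column rank. -/
theorem ApproxTo.solution (he : Tendsto e l (𝓝 0)) {A : X → m → n → ℂ} {A0 : m → n → ℂ}
    {g : X → n → ℂ} {g0 : n → ℂ} (hA : ∀ i j, ApproxTo l e (fun x => A x i j) (A0 i j))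
    (hind : LinearIndependent ℂ (fun j i => A0 i j))
    (hres : ∀ i, ApproxTo l e (fun x => ∑ j, g x j * A x i j) (∑ j, g0 j * A0 i j)) (j : n) :
    ApproxTo l e (fun x => g x j) (g0 j) := by
  have hker : (Fintype.linearCombination ℂ (fun j i => A0 i j)).ker = ⊥ :=
    LinearMap.ker_eq_bot.2 hind.fintypeLinearCombination_injective
  obtain ⟨B, hB⟩ := LinearMap.exists_leftInverse_of_injective _ hker
  set u : X → n → ℂ := fun x => g x - g0 with hu
  set ρ : X → m → ℂ := fun x i => ∑ j, u x j * A x i j with hρ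
  set κ : X → m → ℂ := fun x i => ∑ j, u x j * (A x i j - A0 i j) with hκ
  -- With `B` a left inverse of the limit system, the error `u` is the image of `A u`, which is
  -- `O(e)`, minus that of `(A - A0) u`, which is `o(u)`.
  have hid : ∀ x, u x = B (ρ x) - B (κ x) := fun x => by
    have := LinearMap.congr_fun hB (u x)
    rw [← map_sub]
    rw [LinearMap.comp_apply, LinearMap.id_apply] at this
    rw [← this]
    congr 1
    · ext i
      simp [hρ, hκ, Fintype.linearCombination_apply, ← Finset.sum_sub_distrib]
      exact Finset.sum_congr rfl fun j _ => by ring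
  have hρO : ρ =O[l] e := isBigO_pi.2 fun i => by
    have h1 := (hres i).sub (ApproxTo.sum (s := Finset.univ)
      fun j _ => (ApproxTo.const (g0 j)).mul he (hA i j))
    refine IsBigO.congr_left h1 fun x => ?_
    simp [hρ, hu, sub_mul, Finset.sum_sub_distrib]
  have hκo : κ =o[l] u := isLittleO_pi.2 fun i => by
    refine IsLittleO.fun_sum fun j _ => ?_
    have h1 : (fun x => u x j) =O[l] fun x => ‖u x‖ :=
      IsBigO.of_norm_le fun x => norm_le_pi_norm (u x) j
    have h2 : (fun x => A x i j - A0 i j) =o[l] fun _ => (1 : ℝ) :=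
      IsBigO.trans_isLittleO (hA i j) ((isLittleO_one_iff ℝ).2 he)
    simpa using h1.mul_isLittleO h2
  have hBo : (fun x => B (κ x)) =o[l] u :=
    (B.toContinuousLinearMap.isBigO_comp κ l).trans_isLittleO hκo
  have hBO : (fun x => B (ρ x)) =O[l] e :=
    (B.toContinuousLinearMap.isBigO_comp ρ l).trans hρO
  -- The `o(u)` term is absorbed into `u`, so no a priori bound on `g` is needed.
  have huO : u =O[l] e := by
    refine hBo.neg_left.right_isBigO_sub.trans (hBO.congr_left fun x => ?_)
    conv_rhs => rw [hid x]
    abel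
  exact isBigO_pi.1 huO j

/-- The objective `∑ i, |b i - ∑ j, g j * A i j|²` of a linear least squares problem. -/
noncomputable def lsqObjective (A : m → n → ℂ) (b : m → ℂ) (g : n → ℂ) : ℝ :=
  ∑ i, ‖b i - ∑ j, g j * A i j‖ ^ 2

/-- The Euclidean norm dominates each entry and is dominated by the sum of absolute values, so
residuals can be compared linearly instead of through squares. -/
theorem norm_residual_le_of_isMinOn {A : m → n → ℂ} {b : m → ℂ} {g : n → ℂ}
    (hg : IsMinOn (lsqObjective A b) Set.univ g) (g' : n → ℂ) (i : m) :
    ‖b i - ∑ j, g j * A i j‖ ≤ ∑ i, ‖b i - ∑ j, g' j * A i j‖ := by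
  have h1 : lsqObjective A b g ≤ lsqObjective A b g' := hg (Set.mem_univ g')
  refine le_of_sq_le_sq ?_ (Finset.sum_nonneg fun _ _ => norm_nonneg _)
  calc ‖b i - ∑ j, g j * A i j‖ ^ 2
      ≤ lsqObjective A b g :=
        Finset.single_le_sum (f := fun i => ‖b i - ∑ j, g j * A i j‖ ^ 2)
          (fun _ _ => sq_nonneg _) (Finset.mem_univ i)
    _ ≤ lsqObjective A b g' := h1
    _ ≤ _ := Finset.sum_sq_le_sq_sum_of_nonneg fun _ _ => norm_nonneg _

/-- Least squares solutions of a perturbed, consistent linear system of full column rank. -/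
theorem ApproxTo.leastSquares (he : Tendsto e l (𝓝 0)) {A : X → m → n → ℂ} {A0 : m → n → ℂ}
    {b : X → m → ℂ} {g : X → n → ℂ} {g0 : n → ℂ}
    (hA : ∀ i j, ApproxTo l e (fun x => A x i j) (A0 i j))
    (hb : ∀ i, ApproxTo l e (fun x => b x i) (∑ j, g0 j * A0 i j))
    (hind : LinearIndependent ℂ (fun j i => A0 i j))
    (hg : ∀ᶠ x in l, IsMinOn (lsqObjective (A x) (b x)) Set.univ (g x)) (j : n) :
    ApproxTo l e (fun x => g x j) (g0 j) := by
  refine ApproxTo.solution he hA hind (fun i => ?_) j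
  -- The exact solution `g0` is a competitor with residual `O(e)`; the minimizer can only do as
  -- well.
  have h1 : ∀ i, (fun x => b x i - ∑ j, g0 j * A x i j) =O[l] e := fun i =>
    IsBigO.congr_left ((hb i).sub (ApproxTo.sum (s := Finset.univ)
      fun j _ => (ApproxTo.const (g0 j)).mul he (hA i j))) fun x => by simp
  have h2 : (fun x => ∑ i, ‖b x i - ∑ j, g0 j * A x i j‖) =O[l] e :=
    IsBigO.fun_sum fun i _ => (h1 i).norm_left
  have h3 : (fun x => b x i - ∑ j, g x j * A x i j) =O[l] e := by
    refine IsBigO.trans (IsBigO.of_bound 1 (hg.mono fun x hx => ?_)) h2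
    rw [one_mul]
    exact (norm_residual_le_of_isMinOn hx g0 i).trans (Real.le_norm_self _)
  exact (IsBigO.sub (hb i) h3).congr_left fun _ => by ring

/-- The range of a linear map is finite-dimensional, hence complete, so it contains a point nearest
to `b`. No rank condition enters. -/
theorem exists_isMinOn_lsqObjective (A : m → n → ℂ) (b : m → ℂ) :
    ∃ g, IsMinOn (lsqObjective A b) Set.univ g := by
  let L : (n → ℂ) →ₗ[ℂ] EuclideanSpace ℂ m :=
    (WithLp.linearEquiv 2 ℂ (m → ℂ)).symm.toLinearMap ∘ₗ
      Fintype.linearCombination ℂ (fun j i => A i j)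
  have hL : ∀ g, ‖WithLp.toLp 2 b - L g‖ ^ 2 = lsqObjective A b g := fun g => by
    rw [EuclideanSpace.norm_sq_eq, lsqObjective]
    refine Finset.sum_congr rfl fun i _ => ?_
    simp [L, Fintype.linearCombination_apply]
  obtain ⟨_, ⟨g, rfl⟩, hg⟩ := Submodule.exists_norm_eq_iInf_of_complete_subspace L.range
    (Submodule.complete_of_finiteDimensional _) (WithLp.toLp 2 b)
  refine ⟨g, fun g' _ => ?_⟩
  have h1 : ‖WithLp.toLp 2 b - L g‖ ≤ ‖WithLp.toLp 2 b - L g'‖ := by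
    rw [hg]
    exact ciInf_le (f := fun w : L.range => ‖WithLp.toLp 2 b - (w : EuclideanSpace ℂ m)‖)
      ⟨0, by rintro _ ⟨w, rfl⟩; exact norm_nonneg _⟩ ⟨L g', g', rfl⟩
  show lsqObjective A b g ≤ lsqObjective A b g'
  rw [← hL, ← hL]
  gcongr

end LeastSquares

/-! ### Perturbation of eigenvectors -/

section Eigen

variable {X : Type*} {l : Filter X} {e : X → ℝ} {n : Type*} [Fintype n]

/-- This makes the open discs of radius `η` about the `μ i` disjoint, so that eigenvalues can be
matched without ambiguity. -/
theorem exists_separation {μ : n → ℂ} (hμ : Function.Injective μ) :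
    ∃ η > 0, ∀ i j, i ≠ j → 2 * η ≤ ‖μ i - μ j‖ := by
  have h : ∀ᶠ η : ℝ in 𝓝[>] 0, ∀ i j, i ≠ j → 2 * η ≤ ‖μ i - μ j‖ := by
    refine eventually_all.2 fun i => eventually_all.2 fun j => ?_
    by_cases hij : i = j
    · simp [hij]
    have hpos : 0 < ‖μ i - μ j‖ := norm_pos_iff.2 (sub_ne_zero.2 (hμ.ne hij))
    filter_upwards [Ioo_mem_nhdsGT (half_pos hpos)] with η hη _
    linarith [hη.2]
  obtain ⟨η, hη, hpos⟩ := (h.and self_mem_nhdsWithin).exists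
  exact ⟨η, hpos, hη⟩

/-- Applied to the roots of a characteristic polynomial: a small value at `μ` forces a root near
`μ`. -/
theorem pow_card_le_norm_prod {η : ℝ} (hη : 0 ≤ η) (μ : ℂ) (s : Multiset ℂ)
    (hs : ∀ z ∈ s, η ≤ ‖μ - z‖) : η ^ s.card ≤ ‖(s.map fun z => μ - z).prod‖ := by
  induction s using Multiset.induction_on with
  | empty => simp
  | cons a s ih =>
    rw [Multiset.card_cons, Multiset.map_cons, Multiset.prod_cons, norm_mul, pow_succ, mul_comm]
    exact mul_le_mul (hs a (Multiset.mem_cons_self a s))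
      (ih fun z hz => hs z (Multiset.mem_cons_of_mem hz)) (by positivity) (norm_nonneg _)

/-- An eigenvalue of the limit matrix is approximated by eigenvalues. -/
theorem eventually_exists_eigenvalue_near [DecidableEq n] {N : X → Matrix n n ℂ}
    {N0 : Matrix n n ℂ} (hN : ∀ i j, Tendsto (fun x => N x i j) l (𝓝 (N0 i j))) {μ : ℂ}
    {v0 : n → ℂ} (hv0 : v0 ≠ 0) (hμ : N0.mulVec v0 = μ • v0) {η : ℝ} (hη : 0 < η) :
    ∀ᶠ x in l, ∃ m : ℂ, ‖m - μ‖ < η ∧ ∃ u : n → ℂ, u ≠ 0 ∧ (N x).mulVec u = m • u := by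
  have hscalar : ∀ (M : Matrix n n ℂ) (m : ℂ) (u : n → ℂ),
      (Matrix.scalar n m - M).mulVec u = m • u - M.mulVec u := fun M m u => by
    rw [Matrix.sub_mulVec]
    congr 1
    ext i
    simp [Matrix.mulVec_diagonal]
  have hdet0 : (Matrix.scalar n μ - N0).det = 0 :=
    Matrix.exists_mulVec_eq_zero_iff.1 ⟨v0, hv0, by rw [hscalar, hμ, sub_self]⟩
  have hcont : Continuous fun M : Matrix n n ℂ => (Matrix.scalar n μ - M).det :=
    (continuous_const.sub continuous_id).matrix_det
  have hNt : Tendsto N l (𝓝 N0) := tendsto_pi_nhds.2 fun i => tendsto_pi_nhds.2 (hN i)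
  have hlim : Tendsto (fun x => ‖(Matrix.scalar n μ - N x).det‖) l (𝓝 0) := by
    have h1 := ((hcont.tendsto N0).comp hNt).norm
    rw [hdet0, norm_zero] at h1
    exact h1
  filter_upwards [hlim.eventually_lt_const (pow_pos hη (Fintype.card n))] with x hx
  by_contra! hcon
  -- The characteristic polynomial at `μ` is the product of `μ - z` over the eigenvalues `z`. It is
  -- smaller than `η` to the power of the dimension, so some eigenvalue is within `η` of `μ`.
  have hsplit : (N x).charpoly.Splits := IsAlgClosed.splits _
  have hcard : (N x).charpoly.roots.card = Fintype.card n := by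
    rw [← hsplit.natDegree_eq_card_roots, Matrix.charpoly_natDegree_eq_dim]
  have heval := hsplit.eval_eq_prod_roots μ
  rw [(N x).charpoly_monic.leadingCoeff, one_mul, Matrix.eval_charpoly] at heval
  rw [heval] at hx
  refine absurd (pow_card_le_norm_prod hη.le μ (N x).charpoly.roots fun z hz => ?_)
    (not_le.2 (hcard ▸ hx))
  by_contra! hlt
  have hroot : (Matrix.scalar n z - N x).det = 0 := by
    rw [← Matrix.eval_charpoly]
    exact Polynomial.isRoot_of_mem_roots hz
  obtain ⟨u, hu, hu'⟩ := Matrix.exists_mulVec_eq_zero_iff.2 hroot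
  rw [hscalar, sub_eq_zero] at hu'
  exact hcon z (by rwa [norm_sub_rev]) u hu hu'.symm

theorem linearIndependent_of_eigenvectors {N : Matrix n n ℂ} {μ : n → ℂ}
    (hμ : Function.Injective μ) {v : n → n → ℂ} (hv : ∀ i, v i ≠ 0)
    (hN : ∀ i, N.mulVec (v i) = μ i • v i) : LinearIndependent ℂ v :=
  Module.End.eigenvectors_linearIndependent' N.mulVecLin μ hμ v fun i =>
    ⟨Module.End.mem_eigenspace_iff.2 (hN i), hv i⟩

/-- A matrix close to one with distinct eigenvalues has a basis of unit eigenvectors. -/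
theorem eventually_exists_eigenbasis [DecidableEq n] {N : X → Matrix n n ℂ}
    {N0 : Matrix n n ℂ} (hN : ∀ i j, Tendsto (fun x => N x i j) l (𝓝 (N0 i j))) {μ : n → ℂ}
    (hμ : Function.Injective μ) {v0 : n → n → ℂ} (hv0 : ∀ i, v0 i ≠ 0)
    (hN0 : ∀ i, N0.mulVec (v0 i) = μ i • v0 i) :
    ∀ᶠ x in l, ∃ v : n → EuclideanSpace ℂ n, (∀ k, ‖v k‖ = 1) ∧
      (∀ k, ∃ m : ℂ, (N x).mulVec (v k).ofLp = m • (v k).ofLp) ∧ LinearIndependent ℂ v := by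
  obtain ⟨η, hη, hsep⟩ := exists_separation hμ
  filter_upwards [eventually_all.2 fun i =>
    eventually_exists_eigenvalue_near hN (hv0 i) (hN0 i) hη] with x hx
  choose m hm u hu hNu using hx
  have hminj : Function.Injective m := fun i j hij => by
    by_contra hne
    have h1 := hsep i j hne
    have h2 : ‖μ i - μ j‖ ≤ ‖m j - μ j‖ + ‖m i - μ i‖ := by
      rw [hij]
      refine (norm_sub_le _ _).trans' (le_of_eq ?_)
      congr 1
      ring
    linarith [hm i, hm j]
  set c : n → ℂ := fun k => ((‖WithLp.toLp 2 (u k)‖⁻¹ : ℝ) : ℂ) with hc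
  have hpos : ∀ k, ‖WithLp.toLp 2 (u k)‖ ≠ 0 := fun k h =>
    hu k ((WithLp.toLp_eq_zero 2).1 (norm_eq_zero.1 h))
  have hc0 : ∀ k, c k ≠ 0 := fun k => Complex.ofReal_ne_zero.2 (inv_ne_zero (hpos k))
  have heig : ∀ k, (N x).mulVec (c k • u k) = m k • (c k • u k) := fun k => by
    rw [Matrix.mulVec_smul, hNu, smul_comm]
  refine ⟨fun k => WithLp.toLp 2 (c k • u k), fun k => ?_, fun k => ⟨m k, heig k⟩, ?_⟩
  · show ‖WithLp.toLp 2 (c k • u k)‖ = 1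
    rw [WithLp.toLp_smul, norm_smul, hc, Complex.norm_real, norm_inv, norm_norm,
      inv_mul_cancel₀ (hpos k)]
  · exact (linearIndependent_of_eigenvectors hminj (fun k => smul_ne_zero (hc0 k) (hu k))
      heig).map' (WithLp.linearEquiv 2 ℂ (n → ℂ)).symm.toLinearMap (LinearEquiv.ker _)

theorem linearIndependent_ofLp {ι : Type*} {v : ι → EuclideanSpace ℂ ι} (h : LinearIndependent ℂ v) :
    LinearIndependent ℂ fun k => (v k).ofLp :=
  h.map' (WithLp.linearEquiv 2 ℂ (ι → ℂ)).toLinearMap (LinearEquiv.ker _)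

/-- The basis of `n → ℂ` given by linearly independent vectors. -/
noncomputable def basisOfIndep [DecidableEq n] {v : n → n → ℂ} (h : LinearIndependent ℂ v) :
    Module.Basis n ℂ (n → ℂ) :=
  basisOfLinearIndependentOfCardEqFinrank' v h (by simp)

@[simp] theorem coe_basisOfIndep [DecidableEq n] {v : n → n → ℂ}
    (h : LinearIndependent ℂ v) : ⇑(basisOfIndep h) = v :=
  coe_basisOfLinearIndependentOfCardEqFinrank' ..

/-- The coordinate functionals of an eigenbasis are left eigenvectors of `N`. -/
theorem coord_mulVec [DecidableEq n] {N : Matrix n n ℂ} {μ : n → ℂ} {v : n → n → ℂ}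
    (h : LinearIndependent ℂ v) (hN : ∀ i, N.mulVec (v i) = μ i • v i) (j : n) (u : n → ℂ) :
    (basisOfIndep h).coord j (N.mulVec u) = μ j * (basisOfIndep h).coord j u := by
  have : (basisOfIndep h).coord j ∘ₗ N.mulVecLin = μ j • (basisOfIndep h).coord j := by
    refine (basisOfIndep h).ext fun i => ?_
    rw [LinearMap.comp_apply, Matrix.mulVecLin_apply]
    have hb : basisOfIndep h i = v i := by simp
    have h2 : N.mulVec (basisOfIndep h i) = μ i • basisOfIndep h i := by rw [hb, hN]
    rw [h2, map_smul, LinearMap.smul_apply, Module.Basis.coord_apply, Module.Basis.repr_self]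
    by_cases hij : i = j
    · simp [hij]
    · simp [hij]
  exact LinearMap.congr_fun this u

/-- As the `v k` form a basis, every eigenvalue of `N` belongs to some `v k`. Disjointness of the
discs makes the resulting choice of `k` injective, hence a permutation. -/
theorem exists_perm_of_eigenvalues_near [DecidableEq n] {N : Matrix n n ℂ} {μ : n → ℂ} {η : ℝ}
    (hsep : ∀ i j, i ≠ j → 2 * η ≤ ‖μ i - μ j‖) {v : n → EuclideanSpace ℂ n}
    (hv : ∀ k, ∃ m : ℂ, N.mulVec (v k).ofLp = m • (v k).ofLp) (hind : LinearIndependent ℂ v)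
    (hnear : ∀ i, ∃ m : ℂ, ‖m - μ i‖ < η ∧ ∃ u : n → ℂ, u ≠ 0 ∧ N.mulVec u = m • u) :
    ∃ σ : Equiv.Perm n, ∀ i, ∃ m : ℂ, ‖m - μ i‖ < η ∧
      N.mulVec (v (σ i)).ofLp = m • (v (σ i)).ofLp := by
  choose m hm using hv
  have hex : ∀ i, ∃ k, ‖m k - μ i‖ < η := fun i => by
    obtain ⟨z, hz, u, hu, hNu⟩ := hnear i
    set b := basisOfIndep (linearIndependent_ofLp hind)
    obtain ⟨k, hk⟩ : ∃ k, b.coord k u ≠ 0 := by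
      by_contra! hcon
      exact hu (b.forall_coord_eq_zero_iff.1 hcon)
    have h1 := coord_mulVec (linearIndependent_ofLp hind) hm k u
    rw [hNu, map_smul, smul_eq_mul] at h1
    exact ⟨k, mul_right_cancel₀ hk h1 ▸ hz⟩
  choose s hs using hex
  have hsinj : Function.Injective s := fun i j hij => by
    by_contra hne
    have h1 := hsep i j hne
    have h2 : ‖μ i - μ j‖ ≤ ‖m (s j) - μ j‖ + ‖m (s i) - μ i‖ := by
      rw [hij]
      refine (norm_sub_le _ _).trans' (le_of_eq ?_)
      congr 1
      ring
    linarith [hs i, hs j]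
  exact ⟨Equiv.ofBijective s (Finite.injective_iff_bijective.1 hsinj),
    fun i => ⟨m (s i), hs i, hm (s i)⟩⟩

/-- A unit vector close to the line through the unit vector `v` is close to `v` up to a phase. -/
theorem exists_phase {E : Type*} [NormedAddCommGroup E] [NormedSpace ℂ E] {u v : E}
    (hu : ‖u‖ = 1) (hv : ‖v‖ = 1) (a : ℂ) :
    ∃ c : ℂ, ‖c‖ = 1 ∧ ‖c • u - v‖ ≤ 2 * ‖u - a • v‖ := by
  -- The phase `c` rotates `a` to `|a|`, and `||a| - 1|` is at most the distance of `u` from `a •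
  -- v`.
  obtain ⟨c, hc, hca⟩ : ∃ c : ℂ, ‖c‖ = 1 ∧ c * a = (‖a‖ : ℂ) := by
    by_cases ha : a = 0
    · exact ⟨1, by simp [ha]⟩
    · refine ⟨‖a‖ / a, ?_, by field_simp⟩
      rw [norm_div, Complex.norm_real, norm_norm, div_self (norm_ne_zero_iff.2 ha)]
  refine ⟨c, hc, ?_⟩
  have h1 : c • u - v = c • (u - a • v) + ((‖a‖ : ℂ) - 1) • v := by
    rw [smul_sub, smul_smul, hca, sub_smul, one_smul]
    abel
  have h2 : ‖(‖a‖ : ℂ) - 1‖ ≤ ‖u - a • v‖ := by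
    have h3 : ‖(‖a‖ : ℂ) - 1‖ = |‖u‖ - ‖a • v‖| := by
      rw [hu, norm_smul, hv, mul_one, abs_sub_comm, ← Complex.ofReal_one, ← Complex.ofReal_sub,
        Complex.norm_real, Real.norm_eq_abs]
    exact h3 ▸ abs_norm_sub_norm_le _ _
  calc ‖c • u - v‖ ≤ ‖c • (u - a • v)‖ + ‖((‖a‖ : ℂ) - 1) • v‖ := h1 ▸ norm_add_le _ _
    _ ≤ ‖u - a • v‖ + ‖u - a • v‖ := by
      rw [norm_smul, norm_smul, hc, hv, one_mul, mul_one]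
      gcongr
    _ = _ := by ring

/-- Perturbation of the eigenvectors of a matrix with distinct eigenvalues. -/
theorem exists_eigenvector_matching [DecidableEq n] (he : Tendsto e l (𝓝 0))
    {N : X → Matrix n n ℂ} {N0 : Matrix n n ℂ}
    (hN : ∀ i j, ApproxTo l e (fun x => N x i j) (N0 i j)) {μ : n → ℂ}
    (hμ : Function.Injective μ) {v0 : n → EuclideanSpace ℂ n} (hv0 : ∀ i, ‖v0 i‖ = 1)
    (hN0 : ∀ i, N0.mulVec (v0 i).ofLp = μ i • (v0 i).ofLp) {v : X → n → EuclideanSpace ℂ n}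
    (hunit : ∀ᶠ x in l, ∀ k, ‖v x k‖ = 1)
    (heig : ∀ᶠ x in l, ∀ k, ∃ m : ℂ, (N x).mulVec (v x k).ofLp = m • (v x k).ofLp)
    (hind : ∀ᶠ x in l, LinearIndependent ℂ (v x)) :
    ∃ (σ : X → Equiv.Perm n) (c : X → n → ℂ), (∀ x i, ‖c x i‖ = 1) ∧
      ∀ i, ApproxTo l e (fun x => c x i • v x (σ x i)) (v0 i) := by
  obtain ⟨η, hη, hsep⟩ := exists_separation hμ
  have hne : ∀ i, (v0 i).ofLp ≠ 0 := fun i h => by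
    have := hv0 i
    rw [(WithLp.ofLp_eq_zero 2).1 h] at this
    simp at this
  have hnear := eventually_all.2 fun i => eventually_exists_eigenvalue_near
    (fun i j => (hN i j).tendsto he) (hne i) (hN0 i) hη
  -- A matching exists only eventually; elsewhere the identity serves as default, so that `σ` is
  -- defined on all of `X`.
  have hσ : ∀ x, ∃ σ : Equiv.Perm n, (∃ σ : Equiv.Perm n, ∀ i, ∃ m : ℂ, ‖m - μ i‖ < η ∧
      (N x).mulVec (v x (σ i)).ofLp = m • (v x (σ i)).ofLp) → ∀ i, ∃ m : ℂ, ‖m - μ i‖ < η ∧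
      (N x).mulVec (v x (σ i)).ofLp = m • (v x (σ i)).ofLp := fun x => by
    by_cases h : ∃ σ : Equiv.Perm n, ∀ i, ∃ m : ℂ, ‖m - μ i‖ < η ∧
      (N x).mulVec (v x (σ i)).ofLp = m • (v x (σ i)).ofLp
    · exact ⟨h.choose, fun _ => h.choose_spec⟩
    · exact ⟨1, fun h' => absurd h' h⟩
  choose σ hσ using hσ
  have hσ' : ∀ᶠ x in l, ∀ i, ∃ m : ℂ, ‖m - μ i‖ < η ∧
      (N x).mulVec (v x (σ x i)).ofLp = m • (v x (σ x i)).ofLp := by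
    filter_upwards [heig, hind, hnear] with x h1 h2 h3
    exact hσ x (exists_perm_of_eigenvalues_near hsep h1 h2 h3)
  have hind0 : LinearIndependent ℂ fun i => (v0 i).ofLp :=
    linearIndependent_of_eigenvectors hμ hne hN0
  set φ := (basisOfIndep hind0).coord with hφ
  -- Testing `(N0 - N) v` against the left eigenvector `φ j` of `N0` gives `(μ j - m) φ j v`. The
  -- left side is `O(e)` and `|μ j - m| ≥ η`.
  have hcoord : ∀ i j, j ≠ i → (fun x => φ j (v x (σ x i)).ofLp) =O[l] e := fun i j hji => by
    have h1 : (fun x => (N0 - N x).mulVec (v x (σ x i)).ofLp) =O[l] e := by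
      refine isBigO_pi.2 fun a => IsBigO.fun_sum fun b _ => ?_
      have hb : (fun x => v x (σ x i) b) =O[l] fun _ => (1 : ℝ) := by
        refine IsBigO.of_bound 1 (hunit.mono fun x hx => ?_)
        simpa [hx] using PiLp.norm_apply_le (v x (σ x i)) b
      have hab : (fun x => (N0 - N x) a b) =O[l] e :=
        IsBigO.congr_left (hN a b).neg_left fun x => by simp
      simpa using hab.mul hb
    have h2 : (fun x => φ j ((N0 - N x).mulVec (v x (σ x i)).ofLp)) =O[l] e :=
      ((φ j).toContinuousLinearMap.isBigO_comp _ l).trans h1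
    refine IsBigO.trans (IsBigO.of_bound η⁻¹ (hσ'.mono fun x hx => ?_)) h2
    obtain ⟨m, hm, hNv⟩ := hx i
    have h3 : φ j ((N0 - N x).mulVec (v x (σ x i)).ofLp) =
        (μ j - m) * φ j (v x (σ x i)).ofLp := by
      rw [Matrix.sub_mulVec, map_sub, hφ, coord_mulVec hind0 hN0, hNv, map_smul, smul_eq_mul,
        sub_mul]
    have h4 : η ≤ ‖μ j - m‖ := by
      have h5 : ‖μ j - μ i‖ ≤ ‖μ j - m‖ + ‖m - μ i‖ := norm_sub_le_norm_sub_add_norm_sub _ _ _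
      linarith [hsep j i hji]
    rw [h3, norm_mul, inv_mul_eq_div, le_div_iff₀ hη, mul_comm]
    gcongr
  have hc : ∀ x i, ∃ c : ℂ, ‖c‖ = 1 ∧ (‖v x (σ x i)‖ = 1 → ‖c • v x (σ x i) - v0 i‖ ≤
      2 * ‖v x (σ x i) - φ i (v x (σ x i)).ofLp • v0 i‖) := fun x i => by
    by_cases h : ‖v x (σ x i)‖ = 1
    · obtain ⟨c, hc, hc'⟩ := exists_phase h (hv0 i) (φ i (v x (σ x i)).ofLp)
      exact ⟨c, hc, fun _ => hc'⟩
    · exact ⟨1, by simp, fun h' => absurd h' h⟩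
  choose c hc1 hc2 using hc
  refine ⟨σ, c, hc1, fun i => ?_⟩
  -- All coordinates but the `i`-th being `O(e)`, the vector is that close to the line through `v0
  -- i`; the phase then aligns it.
  have hD : (fun x => v x (σ x i) - φ i (v x (σ x i)).ofLp • v0 i) =O[l] e := by
    have h1 : (fun x => ∑ j ∈ Finset.univ.erase i, φ j (v x (σ x i)).ofLp • v0 j) =O[l] e :=
      IsBigO.fun_sum fun j hj => by
        simpa using (hcoord i j (Finset.ne_of_mem_erase hj)).smul
          (isBigO_const_const (v0 j) (one_ne_zero (α := ℝ)) l)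
    refine h1.congr_left fun x => ?_
    rw [eq_sub_iff_add_eq, Finset.sum_erase_add _ _ (Finset.mem_univ i)]
    have h2 := (basisOfIndep hind0).sum_repr (v x (σ x i)).ofLp
    apply WithLp.ofLp_injective 2
    rw [WithLp.ofLp_sum]
    simpa [hφ] using h2
  refine IsBigO.trans (IsBigO.of_bound 2 (hunit.mono fun x hx => ?_)) hD
  exact hc2 x i (hx _)

end Eigen

/-! ### Labels -/

section Labels

variable {d r : ℕ} (h : 2 * r + 2 ≤ d)

theorem zeroLabel_ne_low (k : Fin r) : zeroLabel h ≠ low h k := by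
  simp [zeroLabel, low, Fin.ext_iff]

theorem zeroLabel_ne_high (l : High d r) : zeroLabel h ≠ l.1 := by
  have := l.2
  simp only [zeroLabel, ne_eq, Fin.ext_iff]
  omega

theorem low_ne_high (k : Fin r) (l : High d r) : low h k ≠ l.1 := by
  have := l.2
  have := k.2
  simp only [low, ne_eq, Fin.ext_iff]
  omega

theorem low_injective : Function.Injective (low h : Fin r → Fin d) := fun a b hab => by
  simpa [low, Fin.ext_iff] using hab

theorem label_cases (b : Fin d) :
    b = zeroLabel h ∨ (∃ k, b = low h k) ∨ ∃ l : High d r, b = l.1 := by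
  by_cases h0 : b.val = 0
  · exact Or.inl (Fin.ext h0)
  by_cases hb : b.val ≤ r
  · exact Or.inr (Or.inl ⟨⟨b.val - 1, by omega⟩, Fin.ext (by simp [low]; omega)⟩)
  · exact Or.inr (Or.inr ⟨⟨b, by omega⟩, rfl⟩)

end Labels

/-! ### Decompositions in affine coordinates -/

section Decomposition

variable {d r : ℕ} (h : 2 * r + 2 ≤ d)

/-- The vectors `q k`, scaled to have leading entry `1`. -/
noncomputable def ratio (q : Fin r → EuclideanSpace ℂ (Fin d)) (k : Fin r) (a : Fin d) : ℂ :=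
  q k a / q k (zeroLabel h)

theorem ratio_zero {q : Fin r → EuclideanSpace ℂ (Fin d)} {k : Fin r}
    (hq : q k (zeroLabel h) ≠ 0) : ratio h q k (zeroLabel h) = 1 :=
  div_self hq

theorem mul_ratio {q : Fin r → EuclideanSpace ℂ (Fin d)} {k : Fin r}
    (hq : q k (zeroLabel h) ≠ 0) (a : Fin d) : q k (zeroLabel h) * ratio h q k a = q k a :=
  mul_div_cancel₀ _ hq

theorem sumCubes_eq {q : Fin r → EuclideanSpace ℂ (Fin d)} (hq : ∀ k, q k (zeroLabel h) ≠ 0)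
    (a b c : Fin d) : sumCubes q a b c =
      ∑ k, q k (zeroLabel h) ^ 3 * (ratio h q k a * ratio h q k b * ratio h q k c) := by
  refine Finset.sum_congr rfl fun k _ => ?_
  rw [← mul_ratio h (hq k) a, ← mul_ratio h (hq k) b, ← mul_ratio h (hq k) c]
  ring

theorem linearIndependent_mul {ι κ : Type*} {v : ι → κ → ℂ} (hv : LinearIndependent ℂ v)
    {c : ι → ℂ} (hc : ∀ i, c i ≠ 0) : LinearIndependent ℂ fun i j => c i * v i j :=
  hv.units_smul fun i => Units.mk0 (c i) (hc i)

theorem linearIndependent_ratio {ι : Type*} {q : Fin r → EuclideanSpace ℂ (Fin d)}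
    (hq : ∀ k, q k (zeroLabel h) ≠ 0) {f : ι → Fin d}
    (hind : LinearIndependent ℂ fun k i => q k (f i)) :
    LinearIndependent ℂ fun k i => ratio h q k (f i) := by
  convert linearIndependent_mul hind (c := fun k => (q k (zeroLabel h))⁻¹)
    (fun k => inv_ne_zero (hq k)) using 3
  rw [ratio, div_eq_inv_mul]

/-- Square systems: a vector orthogonal to all rows of an invertible matrix vanishes. -/
theorem eq_zero_of_forall_sum_eq_zero {n : Type*} [Fintype n] [DecidableEq n] {x : n → n → ℂ}
    (hx : LinearIndependent ℂ x) {c : n → ℂ} (hc : ∀ m, ∑ k, c k * x m k = 0) : c = 0 := by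
  have hu : IsUnit (Matrix.of x) := Matrix.linearIndependent_rows_iff_isUnit.1 hx
  refine (Matrix.mulVec_injective_iff_isUnit.2 hu) ?_
  rw [Matrix.mulVec_zero]
  ext m
  simpa [Matrix.mulVec, dotProduct, mul_comm] using hc m

/-- The array is `Xᵀ diag(c) W` with `X` invertible. Slices `F (0, k, l)` have this shape, whence
the full column rank in Step 1. -/
theorem linearIndependent_of_factor {n κ : Type*} [Fintype n] [DecidableEq n] {c : n → ℂ}
    (hc : ∀ m, c m ≠ 0) {x : n → n → ℂ} (hx : LinearIndependent ℂ x) {w : n → κ → ℂ}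
    (hw : LinearIndependent ℂ w) :
    LinearIndependent ℂ fun k l => ∑ m, c m * (x m k * w m l) := by
  refine Fintype.linearIndependent_iff.2 fun g hg => ?_
  have h1 : ∑ m, (c m * ∑ k, g k * x m k) • w m = 0 := by
    ext l
    have := congrFun hg l
    simp only [Finset.sum_apply, Pi.smul_apply, smul_eq_mul, Pi.zero_apply, Finset.mul_sum,
      Finset.sum_mul] at this ⊢
    rw [Finset.sum_comm] at this
    rw [← this]
    exact Finset.sum_congr rfl fun m _ => Finset.sum_congr rfl fun k _ => by ring
  have h2 := Fintype.linearIndependent_iff.1 hw _ h1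
  exact congrFun (eq_zero_of_forall_sum_eq_zero hx fun m =>
    (mul_eq_zero.1 (h2 m)).resolve_left (hc m))

/-- Conversely, a factorization of independent vectors through a square matrix has a factor
with independent rows. -/
theorem linearIndependent_of_linearIndependent_sum {n κ : Type*} [Fintype n] [DecidableEq n]
    {x : n → n → ℂ} {w : n → κ → ℂ}
    (hi : LinearIndependent ℂ fun k l => ∑ m, x m k * w m l) : LinearIndependent ℂ x := by
  refine Matrix.linearIndependent_rows_iff_isUnit.2
    ((Matrix.mulVec_injective_iff_isUnit (A := Matrix.of x)).1 ?_)
  rw [← Matrix.coe_mulVecLin, ← LinearMap.ker_eq_bot, LinearMap.ker_eq_bot']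
  intro c hc
  refine funext (Fintype.linearIndependent_iff.1 hi c ?_)
  ext l
  simp only [Finset.sum_apply, Pi.smul_apply, smul_eq_mul, Pi.zero_apply, Finset.mul_sum]
  rw [Finset.sum_comm]
  refine Finset.sum_eq_zero fun m _ => ?_
  have h1 : ∑ k, x m k * c k = 0 := congrFun hc m
  rw [← zero_mul (w m l), ← h1, Finset.sum_mul]
  exact Finset.sum_congr rfl fun k _ => by ring

/-! ### The generating matrix of a decomposition -/

/-- The vectors `x m` are eigenvectors of each `N_l(G)`, for the eigenvalue `w m l`. -/
def HasEigenpairs (G : GenMatrix d r) (x : Fin r → Fin r → ℂ) (w : Fin r → High d r → ℂ) : Prop :=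
  ∀ l m, (Nmat G l).mulVec (x m) = w m l • x m

theorem HasEigenpairs.sum_eq {G : GenMatrix d r} {x : Fin r → Fin r → ℂ}
    {w : Fin r → High d r → ℂ} (hG : HasEigenpairs G x w) (l : High d r) (m i : Fin r) :
    ∑ k, G k i l * x m k = w m l * x m i :=
  congrFun (hG l m) i

/-- Each `N_l(G)` is prescribed on the basis `x`. Note that `G k i l` is its entry at `(i, k)`. -/
theorem exists_hasEigenpairs {x : Fin r → Fin r → ℂ} (hx : LinearIndependent ℂ x)
    (w : Fin r → High d r → ℂ) : ∃ G : GenMatrix d r, HasEigenpairs G x w := by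
  set b := basisOfIndep hx
  refine ⟨fun k i l => LinearMap.toMatrix' (b.constr ℂ fun m => w m l • x m) i k, fun l m => ?_⟩
  have hN : Nmat (fun k i l => LinearMap.toMatrix' (b.constr ℂ fun m => w m l • x m) i k) l =
      LinearMap.toMatrix' (b.constr ℂ fun m => w m l • x m) := rfl
  rw [hN, LinearMap.toMatrix'_mulVec]
  have hb : b m = x m := by simp [b]
  rw [← hb, b.constr_basis, hb]

theorem HasEigenpairs.Nxi_mulVec {G : GenMatrix d r} {x : Fin r → Fin r → ℂ}
    {w : Fin r → High d r → ℂ} (hG : HasEigenpairs G x w) (ξ : High d r → ℂ) (m : Fin r) :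
    (Nxi ξ G).mulVec (x m) = (∑ l, ξ l * w m l) • x m := by
  rw [Nxi, Matrix.sum_mulVec, Finset.sum_smul]
  refine Finset.sum_congr rfl fun l _ => ?_
  rw [Matrix.smul_mulVec, hG, smul_smul]

/-- The generating relation at the labels `i`, `j`, tested on a decomposition. -/
theorem HasEigenpairs.sum_sumCubes {q : Fin r → EuclideanSpace ℂ (Fin d)}
    (hq : ∀ k, q k (zeroLabel h) ≠ 0) {G : GenMatrix d r}
    (hG : HasEigenpairs G (fun m k => ratio h q m (low h k)) (fun m l => ratio h q m l.1))
    (i : Fin r) (j : High d r) (t : Fin d) :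
    ∑ k, G k i j * sumCubes q (zeroLabel h) (low h k) t = sumCubes q (low h i) j.1 t := by
  simp only [sumCubes_eq h hq, ratio_zero h (hq _), one_mul, Finset.mul_sum]
  rw [Finset.sum_comm]
  refine Finset.sum_congr rfl fun m _ => ?_
  calc _ = q m (zeroLabel h) ^ 3 * ratio h q m t * ∑ k, G k i j * ratio h q m (low h k) := by
        rw [Finset.mul_sum]
        exact Finset.sum_congr rfl fun k _ => by ring
    _ = _ := by
        rw [hG.sum_eq j m i]
        ring

/-- Eigenvalues on a basis of eigenvectors are distinct if the characteristic polynomial has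
distinct roots. -/
theorem injective_of_distinctEigenvalues {M : Matrix (Fin r) (Fin r) ℂ}
    (hM : DistinctEigenvalues M) {x : Fin r → Fin r → ℂ} (hx : LinearIndependent ℂ x)
    {μ : Fin r → ℂ} (hμ : ∀ m, M.mulVec (x m) = μ m • x m) : Function.Injective μ := by
  have hdiag : LinearMap.toMatrix (basisOfIndep hx) (basisOfIndep hx) M.mulVecLin =
      Matrix.diagonal μ := by
    ext i j
    rw [LinearMap.toMatrix_apply, Matrix.mulVecLin_apply]
    have hb : basisOfIndep hx j = x j := by simp
    have h2 : M.mulVec (basisOfIndep hx j) = μ j • basisOfIndep hx j := by rw [hb, hμ]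
    rw [h2, map_smul, Module.Basis.repr_self]
    by_cases hij : j = i
    · simp [hij]
    · simp [hij, Matrix.diagonal_apply_ne' _ hij]
  have hchar : M.charpoly = ∏ i, (Polynomial.X - Polynomial.C (μ i)) := by
    rw [← Matrix.charpoly_diagonal, ← hdiag, LinearMap.charpoly_toMatrix,
      ← Matrix.toLin'_apply', Matrix.charpoly_toLin']
  have hroots : M.charpoly.roots = Finset.univ.val.map μ := by
    rw [hchar, ← Polynomial.roots_multiset_prod_X_sub_C (Finset.univ.val.map μ),
      Multiset.map_map]
    rfl
  rw [DistinctEigenvalues, hroots] at hM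
  exact fun i j hij => Multiset.inj_on_of_nodup_map hM i (Finset.mem_univ_val i) j
    (Finset.mem_univ_val j) hij

/-- The hypotheses on the decomposition, with those on the eigenvalues made explicit. -/
structure Regular (ξ : High d r → ℂ) (p : Fin r → EuclideanSpace ℂ (Fin d)) : Prop where
  lead : ∀ k, p k (zeroLabel h) ≠ 0
  low_indep : LinearIndependent ℂ fun m k => ratio h p m (low h k)
  high_indep : ∀ j : High d r,
    LinearIndependent ℂ fun m (l : {l : High d r // l ≠ j}) => ratio h p m l.1.1
  eig : Function.Injective fun m => ∑ l : High d r, ξ l * ratio h p m l.1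

/-- The hypothesis on eigenvalues speaks of every generating matrix, so it may be applied to the one
built from the eigenpairs; uniqueness of `G` plays no role. -/
theorem Regular.of_distinctEigenvalues {ξ : High d r → ℂ}
    {p : Fin r → EuclideanSpace ℂ (Fin d)} (h0 : ∀ i, p i (zeroLabel h) ≠ 0)
    (hlow : LinearIndependent ℂ (fun (i : Fin r) (k : Fin r) => p i (low h k)))
    (hhigh : ∀ j : High d r,
      LinearIndependent ℂ (fun (i : Fin r) (l : {l : High d r // l ≠ j}) => p i l.1.1))
    (heig : ∀ G : GenMatrix d r, IsGeneratingMatrix h (sumCubes p) G →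
      DistinctEigenvalues (Nxi ξ G)) : Regular h ξ p := by
  have hx := linearIndependent_ratio h h0 hlow
  refine ⟨h0, hx, fun j => linearIndependent_ratio h h0 (hhigh j), ?_⟩
  obtain ⟨G, hG⟩ := exists_hasEigenpairs hx fun m (l : High d r) => ratio h p m l.1
  refine injective_of_distinctEigenvalues (heig G fun i j t => ?_) hx (hG.Nxi_mulVec ξ)
  rw [hG.sum_sumCubes h h0, sub_self]

theorem nonempty_high {d r : ℕ} (h : 2 * r + 2 ≤ d) : Nonempty (High d r) :=
  ⟨⟨⟨d - 1, by omega⟩, show r < d - 1 by omega⟩⟩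

theorem Regular.high_indep' {ξ : High d r → ℂ} {p : Fin r → EuclideanSpace ℂ (Fin d)}
    (hp : Regular h ξ p) : LinearIndependent ℂ fun m (l : High d r) => ratio h p m l.1 := by
  obtain ⟨j⟩ := nonempty_high h
  exact LinearIndependent.of_comp (LinearMap.funLeft ℂ ℂ (Subtype.val : {l // l ≠ j} → _))
    (hp.high_indep j)

end Decomposition

/-! ### Unit eigenvectors and the vectors `wvec` -/

section UnitVectors

variable {d r : ℕ}

/-- The unit vector in the direction of `x`. -/
noncomputable def unitVec (x : Fin r → ℂ) : EuclideanSpace ℂ (Fin r) :=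
  ((‖WithLp.toLp 2 x‖⁻¹ : ℝ) : ℂ) • WithLp.toLp 2 x

theorem norm_toLp_ne_zero {x : Fin r → ℂ} (hx : x ≠ 0) : ‖WithLp.toLp 2 x‖ ≠ 0 := fun h =>
  hx ((WithLp.toLp_eq_zero 2).1 (norm_eq_zero.1 h))

theorem norm_unitVec {x : Fin r → ℂ} (hx : x ≠ 0) : ‖unitVec x‖ = 1 := by
  rw [unitVec, norm_smul, Complex.norm_real, norm_inv, norm_norm,
    inv_mul_cancel₀ (norm_toLp_ne_zero hx)]

theorem norm_mul_unitVec {x : Fin r → ℂ} (hx : x ≠ 0) (a : Fin r) :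
    (‖WithLp.toLp 2 x‖ : ℂ) * unitVec x a = x a := by
  have := norm_toLp_ne_zero hx
  have h2 : (‖WithLp.toLp 2 x‖ : ℂ) ≠ 0 := Complex.ofReal_ne_zero.2 this
  simp [unitVec, h2]

theorem mulVec_unitVec {M : Matrix (Fin r) (Fin r) ℂ} {x : Fin r → ℂ} {z : ℂ}
    (hM : M.mulVec x = z • x) : M.mulVec (unitVec x).ofLp = z • (unitVec x).ofLp := by
  rw [unitVec, WithLp.ofLp_smul, Matrix.mulVec_smul, hM, smul_comm]

theorem linearIndependent_unitVec {x : Fin r → Fin r → ℂ} (hx : LinearIndependent ℂ x) :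
    LinearIndependent ℂ fun k => unitVec (x k) := by
  have h1 := linearIndependent_mul hx (c := fun k => ((‖WithLp.toLp 2 (x k)‖⁻¹ : ℝ) : ℂ))
    fun k => Complex.ofReal_ne_zero.2 (inv_ne_zero (norm_toLp_ne_zero (hx.ne_zero k)))
  exact h1.map' (WithLp.linearEquiv 2 ℂ (Fin r → ℂ)).symm.toLinearMap (LinearEquiv.ker _)

theorem star_dotProduct_self_of_norm {v : EuclideanSpace ℂ (Fin r)} (hv : ‖v‖ = 1) :
    star v.ofLp ⬝ᵥ v.ofLp = 1 := by
  have h1 := inner_self_eq_norm_sq_to_K (𝕜 := ℂ) v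
  rw [hv, EuclideanSpace.inner_eq_star_dotProduct, dotProduct_comm] at h1
  simpa using h1

theorem wvec_of_eigen {G : GenMatrix d r} {v : EuclideanSpace ℂ (Fin r)} (hv : ‖v‖ = 1)
    {l : High d r} {z : ℂ} (hz : (Nmat G l).mulVec v.ofLp = z • v.ofLp) : wvec G v l = z := by
  rw [wvec, hz, dotProduct_smul, star_dotProduct_self_of_norm hv, smul_eq_mul, mul_one]

/-- The phase cancels because `star c * c = 1`; hence `wvec` is insensitive to the ambiguity of unit
eigenvectors. -/
theorem wvec_smul (G : GenMatrix d r) (v : EuclideanSpace ℂ (Fin r)) {c : ℂ} (hc : ‖c‖ = 1) :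
    wvec G (c • v) = wvec G v := by
  ext l
  have h1 : star c * c = 1 := by
    rw [Complex.star_def, ← Complex.normSq_eq_conj_mul_self, Complex.normSq_eq_norm_sq, hc]
    simp
  rw [wvec, wvec, WithLp.ofLp_smul, Matrix.mulVec_smul, star_smul, smul_dotProduct,
    dotProduct_smul, smul_smul, h1, one_smul]

theorem ApproxTo.wvec {X : Type*} {l : Filter X} {e : X → ℝ} (he : Tendsto e l (𝓝 0))
    {G : X → GenMatrix d r} {G0 : GenMatrix d r} {v : X → EuclideanSpace ℂ (Fin r)}
    {v0 : EuclideanSpace ℂ (Fin r)}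
    (hG : ∀ k i j, ApproxTo l e (fun x => G x k i j) (G0 k i j))
    (hv : ∀ a, ApproxTo l e (fun x => v x a) (v0 a)) (j : High d r) :
    ApproxTo l e (fun x => IncompleteTensor.wvec (G x) (v x) j)
      (IncompleteTensor.wvec G0 v0 j) :=
  ApproxTo.sum fun a _ => (hv a).star.mul he <| ApproxTo.sum fun b _ => (hG b a j).mul he (hv b)

end UnitVectors

/-! ### Perturbation of the generating matrix and of its eigenvectors -/

section Perturbation

variable {d r : ℕ} (h : 2 * r + 2 ≤ d) {ξ : High d r → ℂ}
  {p : Fin r → EuclideanSpace ℂ (Fin d)}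
variable {X : Type*} {l : Filter X} {e : X → ℝ}

/-- The entries of `T x` at triples of distinct labels approximate those of `F`. -/
def ApproxOmega (l : Filter X) (e : X → ℝ) (T : X → Tensor d) (F : Tensor d) : Prop :=
  ∀ a b c, a ≠ b → a ≠ c → b ≠ c → ApproxTo l e (fun x => T x a b c) (F a b c)

theorem genObjective_eq (F : Tensor d) (i : Fin r) (j : High d r) :
    genObjective h F i j = lsqObjective
      (fun (m : {m : High d r // m ≠ j}) k => F (zeroLabel h) (low h k) m.1.1)
      (fun m => F (low h i) j.1 m.1.1) := by
  ext g
  refine Finset.sum_congr rfl fun m _ => ?_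
  rw [Pi.sub_apply, norm_sub_rev]
  simp [Amat, bvec, Matrix.mulVec, dotProduct, mul_comm]

/-- Only entries at `(0, k, m)` and `(i, j, m)` with `m ≠ j` enter, all in `Ω`, and `G0` solves the
limit system exactly. Minimality is required only eventually, so that the result covers generating
matrices of nearby decompositions as well as runs. -/
theorem Regular.approx_genMatrix (hp : Regular h ξ p) (he : Tendsto e l (𝓝 0))
    {T : X → Tensor d} (hT : ApproxOmega l e T (sumCubes p)) {G : X → GenMatrix d r}
    (hG : ∀ᶠ x in l, ∀ i j, IsMinOn (genObjective h (T x) i j) Set.univ fun k => G x k i j)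
    {G0 : GenMatrix d r}
    (hG0 : HasEigenpairs G0 (fun m k => ratio h p m (low h k)) fun m l => ratio h p m l.1)
    (k i : Fin r) (j : High d r) : ApproxTo l e (fun x => G x k i j) (G0 k i j) := by
  refine ApproxTo.leastSquares he
    (A := fun x (m : {m : High d r // m ≠ j}) k => T x (zeroLabel h) (low h k) m.1.1)
    (A0 := fun m k => sumCubes p (zeroLabel h) (low h k) m.1.1)
    (b := fun x m => T x (low h i) j.1 m.1.1) (g := fun x k => G x k i j)
    (g0 := fun k => G0 k i j)
    (fun m k => hT _ _ _ (zeroLabel_ne_low h k) (zeroLabel_ne_high h m.1) (low_ne_high h k m.1))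
    (fun m => ?_) ?_ ?_ k
  · rw [hG0.sum_sumCubes h hp.lead]
    exact hT _ _ _ (low_ne_high h i j) (low_ne_high h i m.1)
      fun hjm => m.2 (Subtype.ext hjm.symm)
  · convert linearIndependent_of_factor (fun m => pow_ne_zero 3 (hp.lead m)) hp.low_indep
      (hp.high_indep j) using 3 with k m
    rw [sumCubes_eq h hp.lead]
    simp only [ratio_zero h (hp.lead _), one_mul]
  · exact hG.mono fun x hx => by simpa only [genObjective_eq] using hx i j

theorem Regular.low_ne_zero (hp : Regular h ξ p) (i : Fin r) :
    (fun k => ratio h p i (low h k)) ≠ 0 :=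
  hp.low_indep.ne_zero i

theorem Regular.exists_matching (hp : Regular h ξ p) (he : Tendsto e l (𝓝 0))
    {G : X → GenMatrix d r} {G0 : GenMatrix d r}
    (hG0 : HasEigenpairs G0 (fun m k => ratio h p m (low h k)) fun m l => ratio h p m l.1)
    (hG : ∀ k i j, ApproxTo l e (fun x => G x k i j) (G0 k i j))
    {v : X → Fin r → EuclideanSpace ℂ (Fin r)} (hunit : ∀ᶠ x in l, ∀ k, ‖v x k‖ = 1)
    (heig : ∀ᶠ x in l, ∀ k, ∃ m : ℂ, (Nxi ξ (G x)).mulVec (v x k).ofLp = m • (v x k).ofLp)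
    (hind : ∀ᶠ x in l, LinearIndependent ℂ (v x)) :
    ∃ (σ : X → Equiv.Perm (Fin r)) (c : X → Fin r → ℂ), (∀ x i, ‖c x i‖ = 1) ∧
      (∀ i a, ApproxTo l e (fun x => c x i * v x (σ x i) a)
        (unitVec (fun k => ratio h p i (low h k)) a)) ∧
      ∀ i j, ApproxTo l e (fun x => wvec (G x) (v x (σ x i)) j) (ratio h p i j.1) := by
  have hentry : ∀ (G : GenMatrix d r) i k, Nxi ξ G i k = ∑ l, ξ l * G k i l := fun G i k => by
    rw [Nxi, Matrix.sum_apply]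
    rfl
  have hN : ∀ i k, ApproxTo l e (fun x => Nxi ξ (G x) i k) (Nxi ξ G0 i k) := fun i k => by
    simp only [hentry]
    exact ApproxTo.sum fun l _ => (ApproxTo.const _).mul he (hG k i l)
  obtain ⟨σ, c, hc, hσ⟩ := exists_eigenvector_matching he hN hp.eig
    (fun i => norm_unitVec (hp.low_ne_zero h i))
    (fun i => mulVec_unitVec (hG0.Nxi_mulVec ξ i)) hunit heig hind
  have hv : ∀ i a, ApproxTo l e (fun x => (c x i • v x (σ x i)) a)
      (unitVec (fun k => ratio h p i (low h k)) a) := fun i a =>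
    ((EuclideanSpace.proj (𝕜 := ℂ) a).isBigO_comp _ l).trans (hσ i)
  refine ⟨σ, c, hc, fun i a => hv i a, fun i j => ?_⟩
  exact (ApproxTo.wvec he hG (hv i) j).congr
    (fun x => by rw [wvec_smul _ _ (hc x i)])
    (wvec_of_eigen (norm_unitVec (hp.low_ne_zero h i)) (mulVec_unitVec (hG0 j i)))

/-- Vectors whose affine coordinates and cubed leading entries approximate those of `p i`
approximate `p i` up to a cube root of unity. -/
theorem Regular.exists_approx_vector (hp : Regular h ξ p) (he : Tendsto e l (𝓝 0)) (i : Fin r)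
    {z : X → ℂ} (hz : ApproxTo l e (fun x => z x ^ 3) (p i (zeroLabel h) ^ 3))
    {y : X → Fin d → ℂ} (hy : ∀ a, ApproxTo l e (fun x => y x a) (ratio h p i a)) :
    ∃ τ : X → ℂ, (∀ x, τ x ^ 3 = 1) ∧
      ApproxTo l e (fun x => τ x • (WithLp.toLp 2 fun a => z x * y x a :
        EuclideanSpace ℂ (Fin d))) (p i) := by
  obtain ⟨τ, hτ, hτz⟩ := exists_cube_root_approx he (hp.lead i) hz
  refine ⟨τ, hτ, ApproxTo.euclidean fun a => (hτz.mul he (hy a)).congr (fun x => ?_)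
    (mul_ratio h (hp.lead i) a)⟩
  simp [mul_assoc]

end Perturbation

/-! ### Stability of the decomposition -/

section Stability

variable {d r : ℕ} (h : 2 * r + 2 ≤ d) {ξ : High d r → ℂ}
  {p : Fin r → EuclideanSpace ℂ (Fin d)}
variable {X : Type*} {l : Filter X} {e : X → ℝ}

/-- Independence of the rows of the slice at `(0, k, j)` is an open condition. For a sum of cubes
that slice factors through the square matrix with entries `q m 0 * q m k`, which must therefore be
invertible. -/
theorem Regular.eventually_nondegenerate (hp : Regular h ξ p) (he : Tendsto e l (𝓝 0))
    {q : X → Fin r → EuclideanSpace ℂ (Fin d)}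
    (hq : ApproxOmega l e (fun x => sumCubes (q x)) (sumCubes p)) :
    ∀ᶠ x in l, (∀ k, q x k (zeroLabel h) ≠ 0) ∧
      LinearIndependent ℂ fun m k => ratio h (q x) m (low h k) := by
  have h0 : LinearIndependent ℂ fun (k : Fin r) (j : High d r) =>
      sumCubes p (zeroLabel h) (low h k) j.1 := by
    convert linearIndependent_of_factor (fun m => pow_ne_zero 3 (hp.lead m)) hp.low_indep
      (hp.high_indep' h) using 3 with k m
    rw [sumCubes_eq h hp.lead]
    simp only [ratio_zero h (hp.lead _), one_mul]
  have hlim : Tendsto (fun x (k : Fin r) (j : High d r) =>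
      sumCubes (q x) (zeroLabel h) (low h k) j.1) l
      (𝓝 fun k j => sumCubes p (zeroLabel h) (low h k) j.1) :=
    tendsto_pi_nhds.2 fun k => tendsto_pi_nhds.2 fun j => (hq _ _ _ (zeroLabel_ne_low h k)
      (zeroLabel_ne_high h j) (low_ne_high h k j)).tendsto he
  filter_upwards [hlim.eventually h0.eventually] with x hx
  have h1 : LinearIndependent ℂ fun m k => q x m (zeroLabel h) * q x m (low h k) :=
    linearIndependent_of_linearIndependent_sum (w := fun m (j : High d r) => q x m j.1) hx
  have hne : ∀ k, q x k (zeroLabel h) ≠ 0 := fun k hk => h1.ne_zero k <| by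
    ext
    simp [hk]
  refine ⟨hne, ?_⟩
  convert linearIndependent_mul h1 (c := fun m => (q x m (zeroLabel h) ^ 2)⁻¹)
    (fun m => inv_ne_zero (pow_ne_zero 2 (hne m))) using 3 with m k
  have := hne m
  rw [ratio]
  field_simp

/-- The objective vanishes here. This lets a decomposition `q` be treated as if Step 1 had been run
on its own tensor. -/
theorem isMinOn_genObjective {q : Fin r → EuclideanSpace ℂ (Fin d)}
    (hq : ∀ k, q k (zeroLabel h) ≠ 0) {G : GenMatrix d r}
    (hG : HasEigenpairs G (fun m k => ratio h q m (low h k)) fun m l => ratio h q m l.1)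
    (i : Fin r) (j : High d r) :
    IsMinOn (genObjective h (sumCubes q) i j) Set.univ fun k => G k i j := by
  refine fun g _ => ?_
  rw [genObjective_eq]
  have h0 : lsqObjective
      (fun (m : {m : High d r // m ≠ j}) k => sumCubes q (zeroLabel h) (low h k) m.1.1)
      (fun m => sumCubes q (low h i) j.1 m.1.1) (fun k => G k i j) = 0 :=
    Finset.sum_eq_zero fun m _ => by rw [hG.sum_sumCubes h hq, sub_self]; simp
  show lsqObjective _ _ _ ≤ _
  rw [h0]
  exact Finset.sum_nonneg fun _ _ => sq_nonneg _

/-- A sum of `r` cubes which is close to that of `p` on `Ω` comes from vectors close to those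
of `p`, up to permutation and cube roots of unity. -/
theorem Regular.exists_approx_of_sumCubes (hp : Regular h ξ p) (he : Tendsto e l (𝓝 0))
    {q : X → Fin r → EuclideanSpace ℂ (Fin d)}
    (hq : ApproxOmega l e (fun x => sumCubes (q x)) (sumCubes p)) :
    ∃ (σ : X → Equiv.Perm (Fin r)) (τ : X → Fin r → ℂ), (∀ x i, τ x i ^ 3 = 1) ∧
      ∀ i, ApproxTo l e (fun x => τ x i • q x (σ x i)) (p i) := by
  have hnd := hp.eventually_nondegenerate h he hq
  obtain ⟨G0, hG0⟩ := exists_hasEigenpairs hp.low_indep fun m (l : High d r) => ratio h p m l.1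
  have hGex : ∀ x, ∃ G : GenMatrix d r,
      (LinearIndependent ℂ fun m k => ratio h (q x) m (low h k)) →
      HasEigenpairs G (fun m k => ratio h (q x) m (low h k)) fun m l => ratio h (q x) m l.1 :=
    fun x => by
      by_cases hx : LinearIndependent ℂ fun m k => ratio h (q x) m (low h k)
      · obtain ⟨G, hG⟩ := exists_hasEigenpairs hx fun m (l : High d r) => ratio h (q x) m l.1
        exact ⟨G, fun _ => hG⟩
      · exact ⟨0, fun hx' => absurd hx' hx⟩
  choose G hGx using hGex
  have hG := hp.approx_genMatrix h he hq (G := G)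
    (hnd.mono fun x hx => isMinOn_genObjective h hx.1 (hGx x hx.2)) hG0
  have hunit : ∀ᶠ x in l, ∀ k, ‖unitVec fun a => ratio h (q x) k (low h a)‖ = 1 :=
    hnd.mono fun x hx k => norm_unitVec (hx.2.ne_zero k)
  -- Only the permutation and the coordinates in `[r + 1, n]` are kept; the other coordinates will
  -- come from linear systems free of phases.
  obtain ⟨σ, -, -, -, hw⟩ := hp.exists_matching h he hG0 hG hunit
    (hnd.mono fun x hx k => ⟨_, mulVec_unitVec ((hGx x hx.2).Nxi_mulVec ξ k)⟩)
    (hnd.mono fun x hx => linearIndependent_unitVec hx.2)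
  replace hw : ∀ i (j : High d r), ApproxTo l e (fun x => ratio h (q x) (σ x i) j.1) (ratio h p i j.1) :=
    fun i j => (hw i j).congr' <| by
      filter_upwards [hnd, hunit] with x hx hx1
      exact wvec_of_eigen (hx1 _) (mulVec_unitVec (hGx x hx.2 j _))
  set lam : X → Fin r → ℂ := fun x i => q x (σ x i) (zeroLabel h) ^ 3 with hlam
  have hsum : ∀ᶠ x in l, ∀ a b, sumCubes (q x) (zeroLabel h) a b = ∑ i, lam x i *
      ratio h (q x) (σ x i) a * ratio h (q x) (σ x i) b := hnd.mono fun x hx a b => by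
    rw [sumCubes_eq h hx.1, ← Equiv.sum_comp (σ x)]
    refine Finset.sum_congr rfl fun i _ => ?_
    rw [ratio_zero h (hx.1 _)]
    ring
  have hsum0 : ∀ a b, sumCubes p (zeroLabel h) a b =
      ∑ i, p i (zeroLabel h) ^ 3 * ratio h p i a * ratio h p i b := fun a b => by
    rw [sumCubes_eq h hp.lead]
    refine Finset.sum_congr rfl fun i _ => ?_
    rw [ratio_zero h (hp.lead _)]
    ring
  -- For fixed `j`, the entries at `(0, j, m)` with `m ≠ j` form a linear system for the numbers `λ
  -- i * (w i)_j`, whose columns are the `w i` with label `j` deleted.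
  have hlamw : ∀ i (j : High d r), ApproxTo l e (fun x => lam x i * ratio h (q x) (σ x i) j.1)
      (p i (zeroLabel h) ^ 3 * ratio h p i j.1) := fun i j =>
    ApproxTo.solution he (g := fun x i => lam x i * ratio h (q x) (σ x i) j.1)
      (g0 := fun i => p i (zeroLabel h) ^ 3 * ratio h p i j.1)
      (A := fun x (m : {m : High d r // m ≠ j}) i => ratio h (q x) (σ x i) m.1.1)
      (A0 := fun m i => ratio h p i m.1.1) (fun m i => hw i m.1) (hp.high_indep j)
      (fun m => ((hq _ _ _ (zeroLabel_ne_high h j) (zeroLabel_ne_high h m.1)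
        fun hjm => m.2 (Subtype.ext hjm.symm)).congr'
          (hsum.mono fun x hx => hx j.1 m.1.1)).congr (fun _ => rfl) (hsum0 _ _)) i
  have hlamx : ∀ i k, ApproxTo l e (fun x => lam x i * ratio h (q x) (σ x i) (low h k))
      (p i (zeroLabel h) ^ 3 * ratio h p i (low h k)) := fun i k =>
    ApproxTo.solution he (g := fun x i => lam x i * ratio h (q x) (σ x i) (low h k))
      (g0 := fun i => p i (zeroLabel h) ^ 3 * ratio h p i (low h k))
      (A := fun x (m : High d r) i => ratio h (q x) (σ x i) m.1)
      (A0 := fun m i => ratio h p i m.1) (fun m i => hw i m) (hp.high_indep' h)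
      (fun m => ((hq _ _ _ (zeroLabel_ne_low h k) (zeroLabel_ne_high h m)
        (low_ne_high h k m)).congr'
          (hsum.mono fun x hx => hx (low h k) m.1)).congr (fun _ => rfl) (hsum0 _ _)) i
  -- Dividing by a nonzero coordinate of `w i` isolates `λ i`.
  have hlam' : ∀ i, ApproxTo l e (fun x => lam x i) (p i (zeroLabel h) ^ 3) := fun i => by
    obtain ⟨j, hj⟩ := Function.ne_iff.1 ((hp.high_indep' h).ne_zero i)
    refine (((hlamw i j).div he hj (hw i j)).congr' ?_).congr (fun _ => rfl)
      (mul_div_cancel_right₀ _ hj)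
    filter_upwards [((hw i j).tendsto he).eventually_ne hj] with x hx
    exact mul_div_cancel_right₀ _ hx
  have hp3 : ∀ i, p i (zeroLabel h) ^ 3 ≠ 0 := fun i => pow_ne_zero 3 (hp.lead i)
  have hy : ∀ i a, ApproxTo l e (fun x => ratio h (q x) (σ x i) a) (ratio h p i a) :=
    fun i a => by
      obtain rfl | ⟨k, rfl⟩ | ⟨j, rfl⟩ := label_cases h a
      · rw [ratio_zero h (hp.lead i)]
        exact (ApproxTo.const 1).congr' (hnd.mono fun x hx => (ratio_zero h (hx.1 _)).symm)
      · refine (((hlamx i k).div he (hp3 i) (hlam' i)).congr' ?_).congr (fun _ => rfl)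
          (mul_div_cancel_left₀ _ (hp3 i))
        filter_upwards [((hlam' i).tendsto he).eventually_ne (hp3 i)] with x hx
        exact mul_div_cancel_left₀ _ hx
      · exact hw i j
  choose τ hτ hτa using fun i => hp.exists_approx_vector h he i (hlam' i) (hy i)
  refine ⟨σ, fun x i => τ i x, fun x i => hτ i x, fun i => (hτa i).congr' ?_⟩
  filter_upwards [hnd] with x hx
  congr 1
  ext a
  exact mul_ratio h (hx.1 _) a

end Stability

/-! ### Runs of the algorithm -/

section Runs

variable {d r : ℕ} (h : 2 * r + 2 ≤ d) {ξ : High d r → ℂ}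
  {p : Fin r → EuclideanSpace ℂ (Fin d)}
variable {X : Type*} {l : Filter X} {e : X → ℝ}

theorem betaObjective_eq (F : Tensor d) (v : Fin r → EuclideanSpace ℂ (Fin r))
    (w : Fin r → High d r → ℂ) : betaObjective h F v w = lsqObjective
      (fun (m : Fin r × High d r) k => v k m.1 * w k m.2)
      (fun m => F (zeroLabel h) (low h m.1) m.2.1) := by
  ext β
  rw [lsqObjective, Fintype.sum_prod_type]
  rfl

/-- Positions with `a = b` become zero equations, so that the index set stays a full product. -/
theorem thetaObjective_eq (F : Tensor d) (v : Fin r → EuclideanSpace ℂ (Fin r))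
    (w : Fin r → High d r → ℂ) : thetaObjective h F v w = lsqObjective
      (fun (m : (Fin r × Fin r) × High d r) k =>
        (if m.1.1 ≠ m.1.2 then v k m.1.1 * v k m.1.2 else 0) * w k m.2)
      (fun m => if m.1.1 ≠ m.1.2 then F (low h m.1.1) (low h m.1.2) m.2.1 else 0) := by
  ext θ
  rw [lsqObjective, Fintype.sum_prod_type, Fintype.sum_prod_type, thetaObjective]
  refine Finset.sum_congr rfl fun a _ => Finset.sum_congr rfl fun b _ =>
    Finset.sum_congr rfl fun m _ => ?_
  by_cases hab : a = b
  · simp [hab]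
  · simp [hab]

/-- Permuting and rescaling columns only reparametrizes the problem. It moves the permutation and
phases of the eigenvectors onto the coefficients. -/
theorem isMinOn_lsqObjective_reindex {m n : Type*} [Fintype m] [Fintype n]
    {A : m → n → ℂ} {b : m → ℂ} {g : n → ℂ} (hg : IsMinOn (lsqObjective A b) Set.univ g)
    (σ : Equiv.Perm n) {s : n → ℂ} (hs : ∀ j, s j ≠ 0) :
    IsMinOn (lsqObjective (fun i j => s j * A i (σ j)) b) Set.univ fun j => g (σ j) / s j := by
  have key : ∀ g' : n → ℂ, lsqObjective (fun i j => s j * A i (σ j)) b g' =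
      lsqObjective A b fun k => g' (σ.symm k) * s (σ.symm k) := fun g' => by
    refine Finset.sum_congr rfl fun i _ => ?_
    rw [← Equiv.sum_comp σ fun k => g' (σ.symm k) * s (σ.symm k) * A i k]
    simp [mul_assoc]
  intro g' _
  show lsqObjective _ _ _ ≤ lsqObjective _ _ _
  rw [key, key]
  have : (fun k => g (σ (σ.symm k)) / s (σ.symm k) * s (σ.symm k)) = g := by
    ext k
    rw [Equiv.apply_symm_apply, div_mul_cancel₀ _ (hs _)]
  rw [this]
  exact hg (Set.mem_univ _)

/-- On the slice where `f i` is nonzero, a relation among the tensors becomes one among the `w i`.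
For `θ`, `f i` is the off-diagonal part of `v ⊗ v`, which is nonzero exactly when `v` has two
nonzero entries. -/
theorem linearIndependent_tensor {n α κ : Type*} [Fintype n] {w : n → κ → ℂ}
    (hw : LinearIndependent ℂ w) {f : n → α → ℂ} (hf : ∀ i, ∃ a, f i a ≠ 0) :
    LinearIndependent ℂ fun i (m : α × κ) => f i m.1 * w i m.2 := by
  refine Fintype.linearIndependent_iff.2 fun g hg i => ?_
  obtain ⟨a, ha⟩ := hf i
  refine (mul_eq_zero.1 (Fintype.linearIndependent_iff.1 hw (fun i => g i * f i a) ?_ i)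
    ).resolve_right ha
  ext k
  have := congrFun hg (a, k)
  simpa [mul_assoc] using this

/-- The run can be carried out on tensors close to that of `p`. -/
theorem Regular.eventually_nonempty_run (hp : Regular h ξ p) (he : Tendsto e l (𝓝 0))
    {T : X → Tensor d} (hT : ApproxOmega l e T (sumCubes p)) :
    ∀ᶠ x in l, Nonempty (Run h (T x) ξ) := by
  obtain ⟨G0, hG0⟩ := exists_hasEigenpairs hp.low_indep fun m (l : High d r) => ratio h p m l.1
  have hGex : ∀ x i j, ∃ g, IsMinOn (genObjective h (T x) i j) Set.univ g := fun x i j => by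
    rw [genObjective_eq]
    exact exists_isMinOn_lsqObjective _ _
  choose G hGmin using hGex
  have hG := hp.approx_genMatrix h he hT (G := fun x k i j => G x i j k)
    (Eventually.of_forall hGmin) hG0
  have hN : ∀ i k, Tendsto (fun x => Nxi ξ (fun k i j => G x i j k) i k) l (𝓝 (Nxi ξ G0 i k)) :=
    fun i k => by
      simp only [Nxi, Matrix.sum_apply]
      exact tendsto_finsetSum _ fun j _ => ((hG k i j).tendsto he).const_mul (ξ j)
  filter_upwards [eventually_exists_eigenbasis hN hp.eig hp.low_ne_zero
    (hG0.Nxi_mulVec ξ)] with x ⟨v, hv1, hv2, hv3⟩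
  obtain ⟨β, hβ⟩ : ∃ β, IsMinOn (betaObjective h (T x) v
      fun k => wvec (fun k i j => G x i j k) (v k)) Set.univ β := by
    rw [betaObjective_eq]
    exact exists_isMinOn_lsqObjective _ _
  obtain ⟨θ, hθ⟩ : ∃ θ, IsMinOn (thetaObjective h (T x) v
      fun k => wvec (fun k i j => G x i j k) (v k)) Set.univ θ := by
    rw [thetaObjective_eq]
    exact exists_isMinOn_lsqObjective _ _
  exact ⟨⟨fun k i j => G x i j k, hGmin x, v, hv1, hv2, hv3, β, hβ, θ, hθ⟩⟩

/-- The length of the vector of labels `1, …, r` of `p i`, scaled to leading entry `1`. -/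
noncomputable def lowNorm (p : Fin r → EuclideanSpace ℂ (Fin d)) (i : Fin r) : ℂ :=
  (‖WithLp.toLp 2 fun k => ratio h p i (low h k)‖ : ℂ)

/-- Its direction. -/
noncomputable def lowDir (p : Fin r → EuclideanSpace ℂ (Fin d)) (i : Fin r) :
    EuclideanSpace ℂ (Fin r) :=
  unitVec fun k => ratio h p i (low h k)

theorem Regular.lowNorm_ne_zero (hp : Regular h ξ p) (i : Fin r) : lowNorm h p i ≠ 0 :=
  Complex.ofReal_ne_zero.2 (norm_toLp_ne_zero (hp.low_ne_zero h i))

theorem Regular.lowNorm_mul_lowDir (hp : Regular h ξ p) (i a : Fin r) :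
    lowNorm h p i * lowDir h p i a = ratio h p i (low h a) :=
  norm_mul_unitVec (hp.low_ne_zero h i) a

theorem Regular.lowDir_ne_zero (hp : Regular h ξ p) {i a : Fin r} (ha : p i (low h a) ≠ 0) :
    lowDir h p i a ≠ 0 := fun hua => by
  have h1 := hp.lowNorm_mul_lowDir h i a
  rw [hua, mul_zero] at h1
  exact div_ne_zero ha (hp.lead i) h1.symm

/-- The rescaled eigenvector is `c * v`, so the matching coefficient is `β / c`; its limit `λ i *
lowNorm` compensates for normalizing `x i` to unit length. -/
theorem Regular.approx_beta (hp : Regular h ξ p) (he : Tendsto e l (𝓝 0)) {T : X → Tensor d}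
    (hT : ApproxOmega l e T (sumCubes p)) {v : X → Fin r → EuclideanSpace ℂ (Fin r)}
    {w : X → Fin r → High d r → ℂ} {β : X → Fin r → ℂ}
    (hmin : ∀ x, IsMinOn (betaObjective h (T x) (v x) (w x)) Set.univ (β x))
    {σ : X → Equiv.Perm (Fin r)} {c : X → Fin r → ℂ} (hc : ∀ x i, c x i ≠ 0)
    (hv : ∀ i a, ApproxTo l e (fun x => c x i * v x (σ x i) a) (lowDir h p i a))
    (hw : ∀ i (j : High d r), ApproxTo l e (fun x => w x (σ x i) j) (ratio h p i j.1))
    (i : Fin r) : ApproxTo l e (fun x => β x (σ x i) / c x i)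
      (p i (zeroLabel h) ^ 3 * lowNorm h p i) := by
  simp only [betaObjective_eq] at hmin
  refine ApproxTo.leastSquares he (g := fun x i => β x (σ x i) / c x i)
    (g0 := fun i => p i (zeroLabel h) ^ 3 * lowNorm h p i)
    (A := fun x (m : Fin r × High d r) i => c x i * (v x (σ x i) m.1 * w x (σ x i) m.2))
    (A0 := fun m i => lowDir h p i m.1 * ratio h p i m.2.1)
    (b := fun x m => T x (zeroLabel h) (low h m.1) m.2.1)
    (fun m i => ((hv i m.1).mul he (hw i m.2)).congr (fun x => mul_assoc _ _ _) rfl)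
    (fun m => (hT _ _ _ (zeroLabel_ne_low h m.1) (zeroLabel_ne_high h m.2)
      (low_ne_high h m.1 m.2)).congr (fun _ => rfl) ?_)
    (linearIndependent_tensor (f := fun i a => lowDir h p i a) (hp.high_indep' h) fun i => ?_)
    (Eventually.of_forall fun x => isMinOn_lsqObjective_reindex (hmin x) (σ x) (hc x)) i
  · rw [sumCubes_eq h hp.lead]
    refine Finset.sum_congr rfl fun i _ => ?_
    rw [ratio_zero h (hp.lead i), ← hp.lowNorm_mul_lowDir h]
    ring
  · obtain ⟨a, ha⟩ := Function.ne_iff.1 (hp.low_ne_zero h i)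
    exact ⟨a, hp.lowDir_ne_zero h fun h0 => ha (by simp [ratio, h0])⟩

theorem Regular.approx_theta (hp : Regular h ξ p)
    (hp2 : ∀ i, ∃ a b : Fin r, a ≠ b ∧ p i (low h a) ≠ 0 ∧ p i (low h b) ≠ 0)
    (he : Tendsto e l (𝓝 0)) {T : X → Tensor d}
    (hT : ApproxOmega l e T (sumCubes p)) {v : X → Fin r → EuclideanSpace ℂ (Fin r)}
    {w : X → Fin r → High d r → ℂ} {θ : X → Fin r → ℂ}
    (hmin : ∀ x, IsMinOn (thetaObjective h (T x) (v x) (w x)) Set.univ (θ x))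
    {σ : X → Equiv.Perm (Fin r)} {c : X → Fin r → ℂ} (hc : ∀ x i, c x i ≠ 0)
    (hv : ∀ i a, ApproxTo l e (fun x => c x i * v x (σ x i) a) (lowDir h p i a))
    (hw : ∀ i (j : High d r), ApproxTo l e (fun x => w x (σ x i) j) (ratio h p i j.1))
    (i : Fin r) : ApproxTo l e (fun x => θ x (σ x i) / c x i ^ 2)
      (p i (zeroLabel h) ^ 3 * lowNorm h p i ^ 2) := by
  simp only [thetaObjective_eq] at hmin
  refine ApproxTo.leastSquares he (g := fun x i => θ x (σ x i) / c x i ^ 2)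
    (g0 := fun i => p i (zeroLabel h) ^ 3 * lowNorm h p i ^ 2)
    (A := fun x (m : (Fin r × Fin r) × High d r) i => c x i ^ 2 *
      ((if m.1.1 ≠ m.1.2 then v x (σ x i) m.1.1 * v x (σ x i) m.1.2 else 0) * w x (σ x i) m.2))
    (A0 := fun m i => (if m.1.1 ≠ m.1.2 then lowDir h p i m.1.1 * lowDir h p i m.1.2 else 0) *
      ratio h p i m.2.1)
    (b := fun x m => if m.1.1 ≠ m.1.2 then T x (low h m.1.1) (low h m.1.2) m.2.1 else 0)
    (fun m i => ?_) (fun m => ?_)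
    (linearIndependent_tensor (f := fun i (m : Fin r × Fin r) =>
      if m.1 ≠ m.2 then lowDir h p i m.1 * lowDir h p i m.2 else 0) (hp.high_indep' h)
      fun i => ?_)
    (Eventually.of_forall fun x => isMinOn_lsqObjective_reindex (hmin x) (σ x) fun i => pow_ne_zero 2 (hc x i)) i
  · by_cases hm : m.1.1 = m.1.2
    · simpa [hm] using ApproxTo.const (l := l) (e := e) (0 : ℂ)
    · simp only [ne_eq, hm, not_false_eq_true, if_true]
      exact (((hv i m.1.1).mul he (hv i m.1.2)).mul he (hw i m.2)).congr (fun x => by ring) rfl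
  · by_cases hm : m.1.1 = m.1.2
    · simpa [hm] using ApproxTo.const (l := l) (e := e) (0 : ℂ)
    · simp only [ne_eq, hm, not_false_eq_true, if_true]
      refine (hT _ _ _ ((low_injective h).ne hm) (low_ne_high h m.1.1 m.2)
        (low_ne_high h m.1.2 m.2)).congr (fun _ => rfl) ?_
      rw [sumCubes_eq h hp.lead]
      refine Finset.sum_congr rfl fun i _ => ?_
      rw [← hp.lowNorm_mul_lowDir h, ← hp.lowNorm_mul_lowDir h]
      ring
  · obtain ⟨a, b, hab, ha, hb⟩ := hp2 i
    refine ⟨(a, b), ?_⟩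
    simpa [hab] using And.intro (hp.lowDir_ne_zero h ha) (hp.lowDir_ne_zero h hb)

/-- The vectors computed by the algorithm, for tensors close to that of `p`. -/
theorem Regular.exists_approx_of_run (hp : Regular h ξ p)
    (hp2 : ∀ i, ∃ a b : Fin r, a ≠ b ∧ p i (low h a) ≠ 0 ∧ p i (low h b) ≠ 0)
    (he : Tendsto e l (𝓝 0)) {T : X → Tensor d} (hT : ApproxOmega l e T (sumCubes p))
    (R : ∀ x, Run h (T x) ξ) :
    (∀ᶠ x in l, ∀ k, (R x).β k ≠ 0 ∧ (R x).θ k ≠ 0) ∧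
      ∃ (σ : X → Equiv.Perm (Fin r)) (τ : X → Fin r → ℂ), (∀ x i, τ x i ^ 3 = 1) ∧
        ∀ i, ApproxTo l e (fun x => τ x i • (R x).phat (σ x i)) (p i) := by
  obtain ⟨G0, hG0⟩ := exists_hasEigenpairs hp.low_indep fun m (l : High d r) => ratio h p m l.1
  have hG := hp.approx_genMatrix h he hT (G := fun x => (R x).G)
    (Eventually.of_forall fun x => (R x).G_min) hG0
  obtain ⟨σ, c, hc, hv, hw⟩ := hp.exists_matching h he hG0 hG
    (Eventually.of_forall fun x => (R x).v_unit) (Eventually.of_forall fun x => (R x).v_eigen)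
    (Eventually.of_forall fun x => (R x).v_indep)
  replace hv : ∀ i a, ApproxTo l e (fun x => c x i * (R x).v (σ x i) a) (lowDir h p i a) := hv
  have hc0 : ∀ x i, c x i ≠ 0 := fun x i hci => by
    have := hc x i
    rw [hci] at this
    simp at this
  have hβ := hp.approx_beta h he hT (fun x => (R x).β_min) hc0 hv hw
  have hθ := hp.approx_theta h hp2 he hT (fun x => (R x).θ_min) hc0 hv hw
  have hlam0 : ∀ i, p i (zeroLabel h) ^ 3 ≠ 0 := fun i => pow_ne_zero 3 (hp.lead i)
  have hν0 := hp.lowNorm_ne_zero h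
  have hβ0 : ∀ i, p i (zeroLabel h) ^ 3 * lowNorm h p i ≠ 0 := fun i => mul_ne_zero (hlam0 i) (hν0 i)
  have hθ0 : ∀ i, p i (zeroLabel h) ^ 3 * lowNorm h p i ^ 2 ≠ 0 := fun i => mul_ne_zero (hlam0 i) (pow_ne_zero 2 (hν0 i))
  have hne : ∀ᶠ x in l, ∀ i, (R x).β (σ x i) ≠ 0 ∧ (R x).θ (σ x i) ≠ 0 := by
    refine eventually_all.2 fun i => ?_
    filter_upwards [((hβ i).tendsto he).eventually_ne (hβ0 i),
      ((hθ i).tendsto he).eventually_ne (hθ0 i)] with x h1 h2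
    exact ⟨fun h3 => h1 (by rw [h3, zero_div]), fun h3 => h2 (by rw [h3, zero_div])⟩
  refine ⟨hne.mono fun x hx k => by simpa using hx ((σ x).symm k), ?_⟩
  -- The phases cancel in `(β / c)² / (θ / c²)`, and so does the squared length of `x i` in the
  -- limit.
  have hlamR : ∀ i, ApproxTo l e (fun x => (R x).lam (σ x i)) (p i (zeroLabel h) ^ 3) := fun i => by
    refine (((hβ i).mul he (hβ i)).div he (hθ0 i) (hθ i)).congr (fun x => ?_) ?_
    · have := hc0 x i
      rw [Run.lam]
      field_simp
    · have := hlam0 i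
      have := hν0 i
      field_simp
  have hgam : ∀ i a, ApproxTo l e (fun x => (R x).gam (σ x i) * (R x).v (σ x i) a)
      (ratio h p i (low h a)) := fun i a => by
    refine (((hθ i).div he (hβ0 i) (hβ i)).mul he (hv i a)).congr (fun x => ?_) ?_
    · have := hc0 x i
      rw [Run.gam]
      field_simp
    · have := hp.lead i
      have := hν0 i
      rw [← hp.lowNorm_mul_lowDir h]
      field_simp
  set y : Fin r → X → Fin d → ℂ := fun i x a =>
    if h0 : a.val = 0 then 1
    else if ha : a.val ≤ r then
      (R x).gam (σ x i) * (R x).v (σ x i) ⟨a.val - 1, by omega⟩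
    else wvec (R x).G ((R x).v (σ x i)) ⟨a, by omega⟩ with hy
  have hya : ∀ i a, ApproxTo l e (fun x => y i x a) (ratio h p i a) := fun i a => by
    obtain rfl | ⟨k, rfl⟩ | ⟨j, rfl⟩ := label_cases h a
    · rw [ratio_zero h (hp.lead i)]
      exact (ApproxTo.const 1).congr (fun x => by simp [hy, zeroLabel]) rfl
    · refine (hgam i k).congr (fun x => ?_) rfl
      have hk : k.val + 1 ≤ r := k.2
      simp [hy, low, hk]
    · refine (hw i j).congr (fun x => ?_) rfl
      have h1 : ¬ j.1.val = 0 := by have := j.2; omega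
      have h2 : ¬ j.1.val ≤ r := not_le.2 j.2
      simp only [hy, h1, h2, dif_neg, not_false_eq_true]
  -- The cube of the principal root is `λ` for every `λ`, so the choice of branch affects only `τ`.
  choose τ hτ hτa using fun i => hp.exists_approx_vector h he i
    (z := fun x => (R x).lam (σ x i) ^ (1 / 3 : ℂ))
    ((hlamR i).congr (fun x => by simp) rfl) (hya i)
  exact ⟨σ, fun x i => τ i x, fun x i => hτ i x, fun i => hτa i⟩

end Runs

/-! ### The seminorm on `Ω` and closeness up to symmetry -/

section NormOmega

variable {d r : ℕ}

/-- The entries of a tensor at the labels in `Ω`, extended by zero. -/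
noncomputable def omegaPart (T : Tensor d) : EuclideanSpace ℂ (Fin d × Fin d × Fin d) :=
  WithLp.toLp 2 fun m =>
    if m.1 ≠ m.2.1 ∧ m.1 ≠ m.2.2 ∧ m.2.1 ≠ m.2.2 then T m.1 m.2.1 m.2.2 else 0

theorem normOmega_eq (T : Tensor d) : normOmega T = ‖omegaPart T‖ := by
  rw [normOmega, EuclideanSpace.norm_eq, Fintype.sum_prod_type]
  congr 1
  refine Finset.sum_congr rfl fun a _ => ?_
  rw [Fintype.sum_prod_type]
  refine Finset.sum_congr rfl fun b _ => Finset.sum_congr rfl fun c _ => ?_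
  simp only [omegaPart]
  split_ifs <;> simp

theorem omegaPart_sub (S T : Tensor d) : omegaPart (S - T) = omegaPart S - omegaPart T := by
  ext m
  simp only [omegaPart, PiLp.sub_apply]
  split_ifs <;> simp

theorem normOmega_nonneg (T : Tensor d) : 0 ≤ normOmega T := Real.sqrt_nonneg _

theorem normOmega_sub_comm (S T : Tensor d) : normOmega (S - T) = normOmega (T - S) := by
  simp only [normOmega_eq, omegaPart_sub, norm_sub_rev]

theorem normOmega_sub_le (S T U : Tensor d) :
    normOmega (S - U) ≤ normOmega (S - T) + normOmega (T - U) := by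
  simp only [normOmega_eq, omegaPart_sub]
  exact norm_sub_le_norm_sub_add_norm_sub _ _ _

theorem norm_apply_le_normOmega (T : Tensor d) {a b c : Fin d} (hab : a ≠ b) (hac : a ≠ c)
    (hbc : b ≠ c) : ‖T a b c‖ ≤ normOmega T := by
  rw [normOmega_eq]
  simpa [omegaPart, hab, hac, hbc] using PiLp.norm_apply_le (omegaPart T) (a, b, c)

theorem continuous_normOmega_sumCubes_sub (F : Tensor d) :
    Continuous fun q : Fin r → EuclideanSpace ℂ (Fin d) => normOmega (sumCubes q - F) := by
  refine Real.continuous_sqrt.comp (continuous_finsetSum _ fun a _ => continuous_finsetSum _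
    fun b _ => continuous_finsetSum _ fun c _ => ?_)
  split_ifs
  · simp only [Pi.sub_apply, sumCubes]
    fun_prop
  · exact continuous_const

theorem approxOmega_of_normOmega {X : Type*} {l : Filter X} (T : X → Tensor d) (F : Tensor d) :
    ApproxOmega l (fun x => normOmega (T x - F)) T F := fun _ _ _ hab hac hbc =>
  ApproxTo.of_norm_le fun x => norm_apply_le_normOmega (T x - F) hab hac hbc

/-- The perturbation results assign to each `p i` its partner among the `q`, whereas
`CloseUpToSymmetry` goes the other way; hence the inverse permutation. -/
theorem closeUpToSymmetry_of {q p : Fin r → EuclideanSpace ℂ (Fin d)} {η : ℝ}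
    (σ : Equiv.Perm (Fin r)) {τ : Fin r → ℂ} (hτ : ∀ i, τ i ^ 3 = 1)
    (hη : ∀ i, ‖τ i • q (σ i) - p i‖ ≤ η) : CloseUpToSymmetry q p η :=
  ⟨σ.symm, fun i => τ (σ.symm i), fun i => ⟨hτ _, by simpa using hη (σ.symm i)⟩⟩

theorem CloseUpToSymmetry.mono {q p : Fin r → EuclideanSpace ℂ (Fin d)} {η η' : ℝ}
    (hq : CloseUpToSymmetry q p η) (hη : η ≤ η') : CloseUpToSymmetry q p η' := by
  obtain ⟨σ, τ, hτ⟩ := hq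
  exact ⟨σ, τ, fun i => ⟨(hτ i).1, (hτ i).2.trans hη⟩⟩

theorem norm_eq_one_of_cube {z : ℂ} (hz : z ^ 3 = 1) : ‖z‖ = 1 :=
  Complex.norm_eq_one_of_pow_eq_one hz (by norm_num)

/-- Cube roots of unity have modulus one, so replacing `p` by an equivalent decomposition does not
enlarge the error. -/
theorem CloseUpToSymmetry.of_zero {q p p' : Fin r → EuclideanSpace ℂ (Fin d)} {η : ℝ}
    (hq : CloseUpToSymmetry q p η) (hp : CloseUpToSymmetry p' p 0) :
    CloseUpToSymmetry q p' η := by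
  obtain ⟨σ, τ, hτ⟩ := hq
  obtain ⟨σ', τ', hτ'⟩ := hp
  have heq : ∀ j, p (σ' j) = τ' j • p' j := fun j =>
    (sub_eq_zero.1 (norm_le_zero_iff.1 (hτ' j).2)).symm
  refine ⟨σ.trans σ'.symm, fun i => (τ' (σ'.symm (σ i)))⁻¹ * τ i, fun i => ⟨?_, ?_⟩⟩
  · rw [mul_pow, inv_pow, (hτ i).1, (hτ' _).1, inv_one, mul_one]
  set j := σ'.symm (σ i) with hj
  have h1 := norm_eq_one_of_cube (hτ' j).1
  have h0 : τ' j ≠ 0 := fun h => by simp [h] at h1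
  have h2 := (hτ i).2
  have hσ : σ i = σ' j := by simp [hj]
  rw [hσ, heq] at h2
  have h3 : ((τ' j)⁻¹ * τ i) • q i - p' j = (τ' j)⁻¹ • (τ i • q i - τ' j • p' j) := by
    rw [smul_sub, smul_smul, smul_smul, inv_mul_cancel₀ h0, one_smul]
  show ‖((τ' j)⁻¹ * τ i) • q i - p' j‖ ≤ η
  rw [h3, norm_smul, norm_inv, h1, inv_one, one_mul]
  exact h2

theorem CloseUpToSymmetry.norm_le {q p : Fin r → EuclideanSpace ℂ (Fin d)} {η : ℝ}
    (hη : 0 ≤ η) (hq : CloseUpToSymmetry q p η) : ‖q‖ ≤ η + ‖p‖ := by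
  obtain ⟨σ, τ, hτ⟩ := hq
  refine (pi_norm_le_iff_of_nonneg (by positivity)).2 fun i => ?_
  calc ‖q i‖ = ‖τ i • q i‖ := by rw [norm_smul, norm_eq_one_of_cube (hτ i).1, one_mul]
    _ ≤ ‖τ i • q i - p (σ i)‖ + ‖p (σ i)‖ := by
      simpa using norm_add_le (τ i • q i - p (σ i)) (p (σ i))
    _ ≤ η + ‖p‖ := add_le_add (hτ i).2 (norm_le_pi_norm p _)

end NormOmega

/-! ### Uniform statements -/

section Uniform

variable {d r : ℕ} (h : 2 * r + 2 ≤ d) {ξ : High d r → ℂ}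
  {p : Fin r → EuclideanSpace ℂ (Fin d)}

theorem Regular.exists_closeUpToSymmetry_of_sumCubes (hp : Regular h ξ p) :
    ∃ δ > 0, ∃ C > 0, ∀ q : Fin r → EuclideanSpace ℂ (Fin d),
      normOmega (sumCubes q - sumCubes p) ≤ δ →
        CloseUpToSymmetry q p (C * normOmega (sumCubes q - sumCubes p)) := by
  obtain ⟨σ, τ, hτ, hq⟩ := hp.exists_approx_of_sumCubes h (X := Fin r → EuclideanSpace ℂ (Fin d))
    (e := fun q => normOmega (sumCubes q - sumCubes p)) tendsto_comap (q := fun q => q)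
    (approxOmega_of_normOmega _ _)
  obtain ⟨δ, hδ, C, hC, H⟩ := exists_bound_of_approxTo (fun _ => normOmega_nonneg _) hq
  exact ⟨δ, hδ, C, hC, fun q hqδ => closeUpToSymmetry_of (σ q) (hτ q) (H q hqδ)⟩

theorem Regular.exists_nonempty_run (hp : Regular h ξ p) :
    ∃ δ > 0, ∀ T : Tensor d, normOmega (T - sumCubes p) ≤ δ → Nonempty (Run h T ξ) :=
  eventually_comap_zero (e := fun T => normOmega (T - sumCubes p)) (fun _ => normOmega_nonneg _)
    (hp.eventually_nonempty_run h tendsto_comap (T := fun T => T) (approxOmega_of_normOmega _ _))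

theorem Regular.exists_closeUpToSymmetry_of_run (hp : Regular h ξ p)
    (hp2 : ∀ i, ∃ a b : Fin r, a ≠ b ∧ p i (low h a) ≠ 0 ∧ p i (low h b) ≠ 0) :
    ∃ δ > 0, ∃ C > 0, ∀ T : Tensor d, normOmega (T - sumCubes p) ≤ δ → ∀ R : Run h T ξ,
      (∀ k, R.β k ≠ 0 ∧ R.θ k ≠ 0) ∧
        CloseUpToSymmetry R.phat p (C * normOmega (T - sumCubes p)) := by
  obtain ⟨hne, σ, τ, hτ, hq⟩ := hp.exists_approx_of_run h hp2
    -- Taking pairs of a tensor and a run as data makes the bounds uniform over all choices in the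
    -- algorithm.
    (X := Σ T : Tensor d, Run h T ξ)
    (e := fun x => normOmega (x.1 - sumCubes p)) tendsto_comap (T := fun x => x.1)
    (approxOmega_of_normOmega _ _) fun x => x.2
  obtain ⟨δ, hδ, C, hC, H⟩ := exists_bound_of_approxTo (fun _ => normOmega_nonneg _) hq
  obtain ⟨δ', hδ', H'⟩ := eventually_comap_zero (fun _ => normOmega_nonneg _) hne
  refine ⟨min δ δ', lt_min hδ hδ', C, hC, fun T hT R => ⟨H' ⟨T, R⟩ (hT.trans (min_le_right _ _)),
    closeUpToSymmetry_of (σ ⟨T, R⟩) (hτ ⟨T, R⟩) (H ⟨T, R⟩ (hT.trans (min_le_left _ _)))⟩⟩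

end Uniform

/-! ### Uniqueness up to symmetry and existence of optimizers -/

section Uniqueness

variable {d r : ℕ} {p : Fin r → EuclideanSpace ℂ (Fin d)}

/-- Decompositions that agree up to symmetry have the same patterns of nonzero entries. -/
theorem CloseUpToSymmetry.exists_apply_ne_zero {p' : Fin r → EuclideanSpace ℂ (Fin d)}
    (hp : CloseUpToSymmetry p' p 0) (i : Fin r) :
    ∃ j, ∀ a, p' j a ≠ 0 → p i a ≠ 0 := by
  obtain ⟨σ, τ, hτ⟩ := hp
  refine ⟨σ.symm i, fun a ha h0 => ?_⟩
  have h1 := congrArg (fun v : EuclideanSpace ℂ (Fin d) => v a)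
    (sub_eq_zero.1 (norm_le_zero_iff.1 (hτ (σ.symm i)).2))
  simp only [PiLp.smul_apply, smul_eq_mul, Equiv.apply_symm_apply, h0] at h1
  have h2 := norm_eq_one_of_cube (hτ (σ.symm i)).1
  rw [(mul_eq_zero.1 h1).resolve_right ha] at h2
  simp at h2

theorem normOmega_le_of_isOptimizer {T : Tensor d} {q : Fin r → EuclideanSpace ℂ (Fin d)}
    (hq : IsOptimizer T q) (q' : Fin r → EuclideanSpace ℂ (Fin d)) :
    normOmega (sumCubes q - T) ≤ normOmega (sumCubes q' - T) :=
  le_of_sq_le_sq (hq (Set.mem_univ q')) (normOmega_nonneg _)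

/-- The objective ignores entries outside `Ω` and need not be coercive. However, its sublevel set
through `p` lies within `δ / 2 + δ / 2` of the tensor of `p` on `Ω`, so stability bounds it, and
continuity gives a minimizer. -/
theorem exists_isOptimizer {T : Tensor d} {δ C : ℝ} (hC : 0 < C)
    (hδ : ∀ q : Fin r → EuclideanSpace ℂ (Fin d), normOmega (sumCubes q - sumCubes p) ≤ δ →
      CloseUpToSymmetry q p (C * normOmega (sumCubes q - sumCubes p)))
    (hT : normOmega (T - sumCubes p) ≤ δ / 2) :
    ∃ q : Fin r → EuclideanSpace ℂ (Fin d), IsOptimizer T q := by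
  have hδ0 : 0 ≤ δ := by linarith [normOmega_nonneg (T - sumCubes p)]
  obtain ⟨q, hq⟩ := (continuous_normOmega_sumCubes_sub (r := r) T).exists_forall_le_of_isBounded p
    (Metric.isBounded_closedBall (x := 0) (r := C * δ + ‖p‖) |>.subset fun q hq => by
      have h1 : normOmega (sumCubes q - T) ≤ normOmega (sumCubes p - T) := hq
      rw [normOmega_sub_comm (sumCubes p)] at h1
      have h2 : normOmega (sumCubes q - sumCubes p) ≤ δ :=
        (normOmega_sub_le _ T _).trans (by linarith)
      rw [mem_closedBall_zero_iff]
      exact ((hδ q h2).mono (by gcongr)).norm_le (by positivity))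
  refine ⟨q, fun q' _ => ?_⟩
  exact pow_le_pow_left₀ (normOmega_nonneg _) (hq q') 2

end Uniqueness

end IncompleteTensor

/-! ### The main theorem -/

open IncompleteTensor in
theorem theorem4p1 (d r : ℕ) (h : 2 * r + 2 ≤ d) (F : Tensor d) (ξ : High d r → ℂ) :
    -- the threshold and the constant depend only on `F` and `ξ`
    ∃ δ > (0 : ℝ), ∃ C > (0 : ℝ),
      ∀ p : Fin r → EuclideanSpace ℂ (Fin d), F = sumCubes p →
        -- (i) nonzero leading entries
        (∀ i, p i (zeroLabel h) ≠ 0) →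
        -- (ii) the subvectors with labels `1, …, r`
        LinearIndependent ℂ (fun (i : Fin r) (k : Fin r) => p i (low h k)) →
        -- (iii) the subvectors with labels `r + 1, …, n`, label `j` deleted
        (∀ j : High d r,
          LinearIndependent ℂ (fun (i : Fin r) (l : {l : High d r // l ≠ j}) => p i l.1.1)) →
        -- (iv) distinct eigenvalues of `N(ξ)`, built from the generating matrix of `F`
        (∀ G : GenMatrix d r, IsGeneratingMatrix h F G → DistinctEigenvalues (Nxi ξ G)) →
        ∀ Fhat : Tensor d, IsSymmetric Fhat → normOmega (Fhat - F) ≤ δ →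
          -- the algorithm can be carried out
          Nonempty (Run h Fhat ξ) ∧
          (∃ pstar : Fin r → EuclideanSpace ℂ (Fin d), IsOptimizer Fhat pstar) ∧
          -- the vectors of Step 4, when each `(p_i)_{2:r+1}` has two nonzero entries
          ((∀ i, ∃ a b : Fin r, a ≠ b ∧ p i (low h a) ≠ 0 ∧ p i (low h b) ≠ 0) →
            ∀ R : Run h Fhat ξ, (∀ k, R.β k ≠ 0 ∧ R.θ k ≠ 0) ∧
              CloseUpToSymmetry R.phat p (C * normOmega (Fhat - F))) ∧
          -- the vectors of Step 5
          (∀ pstar : Fin r → EuclideanSpace ℂ (Fin d), IsOptimizer Fhat pstar →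
            CloseUpToSymmetry pstar p (C * normOmega (Fhat - F))) := by
  -- The constants must precede `p`, so they are taken from one fixed decomposition `p₀` of `F`; if
  -- there is none, the claim is vacuous.
  by_cases hex : ∃ p : Fin r → EuclideanSpace ℂ (Fin d), F = sumCubes p ∧ Regular h ξ p
  swap
  · refine ⟨1, one_pos, 1, one_pos, fun p hF h0 hlow hhigh heig => absurd ⟨p, hF, ?_⟩ hex⟩
    subst hF
    exact Regular.of_distinctEigenvalues h h0 hlow hhigh heig
  obtain ⟨p₀, rfl, hp₀⟩ := hex
  obtain ⟨δ₁, hδ₁, C₁, hC₁, H₁⟩ := hp₀.exists_closeUpToSymmetry_of_sumCubes h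
  obtain ⟨δ₂, hδ₂, H₂⟩ := hp₀.exists_nonempty_run h
  -- The condition on two nonzero entries is moved inside, because `δ` and `C` are needed even when
  -- it fails.
  obtain ⟨δ₃, hδ₃, C₃, hC₃, H₃⟩ : ∃ δ > 0, ∃ C > 0,
      (∀ i, ∃ a b : Fin r, a ≠ b ∧ p₀ i (low h a) ≠ 0 ∧ p₀ i (low h b) ≠ 0) →
      ∀ T : Tensor d, normOmega (T - sumCubes p₀) ≤ δ → ∀ R : Run h T ξ,
      (∀ k, R.β k ≠ 0 ∧ R.θ k ≠ 0) ∧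
        CloseUpToSymmetry R.phat p₀ (C * normOmega (T - sumCubes p₀)) := by
    by_cases h2 : ∀ i, ∃ a b : Fin r, a ≠ b ∧ p₀ i (low h a) ≠ 0 ∧ p₀ i (low h b) ≠ 0
    · obtain ⟨δ, hδ, C, hC, H⟩ := hp₀.exists_closeUpToSymmetry_of_run h h2
      exact ⟨δ, hδ, C, hC, fun _ => H⟩
    · exact ⟨1, one_pos, 1, one_pos, fun h2' => absurd h2' h2⟩
  refine ⟨min (δ₁ / 2) (min δ₂ δ₃), lt_min (half_pos hδ₁) (lt_min hδ₂ hδ₃), 2 * C₁ + C₃,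
    by positivity, fun p hF _ _ _ _ T _ hT => ?_⟩
  have hT₁ : normOmega (T - sumCubes p₀) ≤ δ₁ / 2 := hT.trans (min_le_left _ _)
  have hT₂ := hT.trans ((min_le_right _ _).trans (min_le_left _ _))
  have hT₃ := hT.trans ((min_le_right _ _).trans (min_le_right _ _))
  have hε := normOmega_nonneg (T - sumCubes p₀)
  have hzero : normOmega (sumCubes p - sumCubes p₀) = 0 := by simp [← hF, normOmega]
  -- Stability with error zero: every other decomposition agrees with `p₀` up to symmetry.
  have hsymm : CloseUpToSymmetry p p₀ 0 := by
    simpa [hzero] using H₁ p (by rw [hzero]; exact hδ₁.le)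
  refine ⟨H₂ T hT₂, exists_isOptimizer hC₁ H₁ hT₁, fun h2 R => ?_, fun q hq => ?_⟩
  · obtain ⟨hne, hclose⟩ := H₃ (fun i => by
      obtain ⟨j, hj⟩ := hsymm.exists_apply_ne_zero i
      obtain ⟨a, b, hab, ha, hb⟩ := h2 j
      exact ⟨a, b, hab, hj _ ha, hj _ hb⟩) T hT₃ R
    exact ⟨hne, (hclose.of_zero hsymm).mono (by gcongr; linarith)⟩
  · have h1 := normOmega_le_of_isOptimizer hq p₀
    rw [normOmega_sub_comm (sumCubes p₀)] at h1
    -- An optimizer fits `T` at least as well as `p₀` does, hence is within `2ε` of `F`; this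
    -- accounts for `δ₁ / 2` and `2 * C₁`.
    have h2 : normOmega (sumCubes q - sumCubes p₀) ≤ 2 * normOmega (T - sumCubes p₀) :=
      (normOmega_sub_le _ T _).trans (by linarith)
    refine ((H₁ q (h2.trans (by linarith))).of_zero hsymm).mono ?_
    calc C₁ * normOmega (sumCubes q - sumCubes p₀)
        ≤ C₁ * (2 * normOmega (T - sumCubes p₀)) := by gcongr
      _ ≤ (2 * C₁ + C₃) * normOmega (T - sumCubes p₀) := by nlinarith
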